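/- Let ${\bf L}$ be a unit exponential random variable. For $0<\alpha<1$ let ${\bf Z}_\alpha$ be the standard positive $\alpha$-stable random variable, that is, the positive random variable with $\mathbb{E}[e^{-\lambda {\bf Z}_\alpha}]=e^{-\lambda^\alpha}$ for all $\lambda\ge 0$. Let ${\bf S}=e^{\bf X}$, where ${\bf X}$ is the real random variable (spectrally negative $1$-stable, with drift coefficient $-1$ and scale parameter $1$) with characteristic function $$\mathbb{E}[e^{i\lambda {\bf X}}]=e^{i\lambda(\log|\lambda|-1)-\pi|\lambda|/2},\qquad \lambda\in\mathbb{R}$$ (with value $1$ at $\lambda=0$). For real random variables $X,Y$, possibly defined on different probability spaces, write $X\leq_{st}Y$ (resp. $X\prec_{cx}Y$) if $\mathbb{E}[\varphi(X)]\le\mathbb{E}[\varphi(Y)]$ for every nondecreasing (resp. every convex) function $\varphi:\mathbb{R}\to\mathbb{R}$ such that both expectations exist in $[-\infty,+\infty]$. For positive $X,Y$ write $X\prec_{st}Y$ if $X\leq_{st}Y$ and there is no $c>1$ such that $cX\leq_{st}Y$. Theorem A. For every $0<\beta<\alpha<1$ one has $${\bf S}\;\prec_{st}\;(1-\alpha)\,\alpha^{\frac{\alpha}{1-\alpha}}\,{\bf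 Z}_\alpha^{-\frac{\alpha}{1-\alpha}}\;\prec_{st}\;(1-\beta)\,\beta^{\frac{\beta}{1-\beta}}\,{\bf Z}_\beta^{-\frac{\beta}{1-\beta}}\;\prec_{st}\;{\bf L}$$ and $${\bf L}\;\prec_{cx}\;(1-\beta)\,{\bf Z}_\beta^{-\frac{\beta}{1-\beta}}\;\prec_{cx}\;(1-\alpha)\,{\bf Z}_\alpha^{-\frac{\alpha}{1-\alpha}}\;\prec_{cx}\;e\,{\bf S}.$$ -/

import Mathlib

open MeasureTheory ProbabilityTheory
open scoped ENNReal

noncomputable section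

/-- The expectation of `f` exists, possibly as an infinite number: the positive part and the
negative part of `f` do not both have infinite expectation. -/
def ExpectationExists {Ω : Type*} [MeasurableSpace Ω] (P : Measure Ω) (f : Ω → ℝ) : Prop :=
  ∫⁻ ω, ENNReal.ofReal (f ω) ∂P ≠ ∞ ∨ ∫⁻ ω, ENNReal.ofReal (-f ω) ∂P ≠ ∞

/-- The expectation of `f`, an extended real number (meaningful when `ExpectationExists P f`):
the expectation of the positive part minus that of the negative part. -/
def extExpectation {Ω : Type*} [MeasurableSpace Ω] (P : Measure Ω) (f : Ω → ℝ) : EReal :=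
  ((∫⁻ ω, ENNReal.ofReal (f ω) ∂P : ℝ≥0∞) : EReal) -
    ((∫⁻ ω, ENNReal.ofReal (-f ω) ∂P : ℝ≥0∞) : EReal)

/-- The usual stochastic order `X ≤_st Y` between a random variable `X` on `(Ω, P)` and a random
variable `Y` on `(Ω', Q)`: `E[φ(X)] ≤ E[φ(Y)]` for all nondecreasing `φ` such that
the expectations exist. -/
def StochasticLE {Ω Ω' : Type*} [MeasurableSpace Ω] [MeasurableSpace Ω']
    (P : Measure Ω) (Q : Measure Ω') (X : Ω → ℝ) (Y : Ω' → ℝ) : Prop :=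
  ∀ φ : ℝ → ℝ, Monotone φ →
    ExpectationExists P (fun ω => φ (X ω)) → ExpectationExists Q (fun ω => φ (Y ω)) →
      extExpectation P (fun ω => φ (X ω)) ≤ extExpectation Q (fun ω => φ (Y ω))

/-- The optimal stochastic order `X ≺_st Y` between positive random variables: `X ≤_st Y`,
and there is no `c > 1` with `c X ≤_st Y`. -/
def OptimalStochasticLE {Ω Ω' : Type*} [MeasurableSpace Ω] [MeasurableSpace Ω']
    (P : Measure Ω) (Q : Measure Ω') (X : Ω → ℝ) (Y : Ω' → ℝ) : Prop :=
  StochasticLE P Q X Y ∧ ¬ ∃ c : ℝ, 1 < c ∧ StochasticLE P Q (fun ω => c * X ω) Y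

/-- The convex order `X ≺_cx Y`: `E[φ(X)] ≤ E[φ(Y)]` for all convex `φ` such that
the expectations exist. -/
def ConvexLE {Ω Ω' : Type*} [MeasurableSpace Ω] [MeasurableSpace Ω']
    (P : Measure Ω) (Q : Measure Ω') (X : Ω → ℝ) (Y : Ω' → ℝ) : Prop :=
  ∀ φ : ℝ → ℝ, ConvexOn ℝ Set.univ φ →
    ExpectationExists P (fun ω => φ (X ω)) → ExpectationExists Q (fun ω => φ (Y ω)) →
      extExpectation P (fun ω => φ (X ω)) ≤ extExpectation Q (fun ω => φ (Y ω))

/-- `Z` is a standard positive `α`-stable random variable: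
`E[exp (-t Z)] = exp (-t ^ α)` for all `t ≥ 0`. -/
structure IsPositiveStable {Ω : Type*} [MeasurableSpace Ω] (P : Measure Ω)
    (α : ℝ) (Z : Ω → ℝ) : Prop where
  aemeasurable : AEMeasurable Z P
  pos : ∀ᵐ ω ∂P, 0 < Z ω
  laplace : ∀ t : ℝ, 0 ≤ t → ∫ ω, Real.exp (-t * Z ω) ∂P = Real.exp (-t ^ α)

/-- `X` is a spectrally negative `1`-stable random variable with drift coefficient `-1` and scale
parameter `1`: its characteristic function is
`t ↦ exp (i t (log |t| - 1) - π |t| / 2)` (with value `1` at `t = 0`). -/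
structure IsSpectrallyNegativeOneStable {Ω : Type*} [MeasurableSpace Ω] (P : Measure Ω)
    (X : Ω → ℝ) : Prop where
  aemeasurable : AEMeasurable X P
  charFun_eq : ∀ t : ℝ, ∫ ω, Complex.exp (Complex.I * t * X ω) ∂P =
    Complex.exp (Complex.I * t * ((Real.log |t| - 1 : ℝ) : ℂ) - ((Real.pi * |t| / 2 : ℝ) : ℂ))

/-- `S` is distributed as `exp X` for the `1`-stable random variable `X` above, i.e. `S` is
(almost surely) positive and its logarithm has the law of `X`. -/
structure IsLogStable {Ω : Type*} [MeasurableSpace Ω] (P : Measure Ω) (S : Ω → ℝ) : Prop where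
  pos : ∀ᵐ ω ∂P, 0 < S ω
  log_stable : IsSpectrallyNegativeOneStable P (fun ω => Real.log (S ω))

end

/-! All variables are compared through one representation: an exponential variable `l` times `exp (g
u)`, with `u` an independent uniform angle on `(0, π)`. By Kanter's factorization (`map_stable_eq`)
the normalized stable variable of index `a` has `g = logKanter a`; the 1-stable exponential has `g =
logKanterOne`, the limit as `a → 1` (`map_logStable_eq`); the exponential law has `g = 0`.

The stochastic order is then pointwise: `logKanter a u` decreases in `a`, because it is built from
difference quotients of a concave function (`logKanter_anti`). No constant `c > 1` can be inserted,
since every `g` involved lies between `logKanterOne` and `0`, which meet as `u → 0`; small angles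
thus give all the tails the exponential rate 1.

For the convex order, the variables are rescaled to have mean 1. The difference of two functions `g`
decreases in `u`, by the same concavity argument applied to the `u`-derivative
(`antitoneOn_logKanter_sub`). Hence the mixing factors cross at most once, and the cut criterion,
applied for each fixed `l`, gives the order (`lintegral_convex_le`).

Kanter's factorization is proved by moments. Those of the stable variable follow from its Laplace
transform. Those of the mixture are generalized binomial coefficients, obtained by integrating `(1 +
z) ^ n * z ^ (-a * n)` in the variable `log z` along a path where the integrand is real and positive
(`integral_pathModulus_pow`). The 1-stable case follows by letting `a = 1 - s / N` with `N → ∞`,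
then continuing analytically from real `s` to the imaginary axis. -/

namespace KanterOrder

open Real Set Filter Topology

/-! ### Concavity of the trigonometric building blocks. -/

noncomputable section

/-- The function `y ↦ y log (sin y / y)`. -/
def mulLogSinc (y : ℝ) : ℝ := y * log (sinc y)

/-- The function `y ↦ y cot y`, with value `1` at `0`. -/
def mulCot (y : ℝ) : ℝ := cos y / sinc y

/-- The function `y ↦ y ^ 2 cot y - y`. -/
def sqCotSub (y : ℝ) : ℝ := y * mulCot y - y

lemma sinc_pos {y : ℝ} (h0 : 0 ≤ y) (hpi : y < π) : 0 < sinc y := by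
  rcases h0.eq_or_lt with rfl | h
  · simp
  · rw [sinc_of_ne_zero h.ne']
    exact div_pos (sin_pos_of_pos_of_lt_pi h hpi) h

lemma mulCot_of_ne_zero {y : ℝ} (hy : y ≠ 0) : mulCot y = y * cos y / sin y := by
  rw [mulCot, sinc_of_ne_zero hy, div_div_eq_mul_div, mul_comm]

lemma mulCot_zero : mulCot 0 = 1 := by simp [mulCot]

lemma continuousOn_log_sinc : ContinuousOn (fun y => log (sinc y)) (Ico 0 π) :=
  continuous_sinc.continuousOn.log fun _ hy => (sinc_pos hy.1 hy.2).ne'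

lemma continuousOn_mulLogSinc : ContinuousOn mulLogSinc (Ico 0 π) :=
  continuousOn_id.mul continuousOn_log_sinc

lemma continuousOn_mulCot : ContinuousOn mulCot (Ico 0 π) :=
  continuous_cos.continuousOn.div continuous_sinc.continuousOn
    fun _ hy => (sinc_pos hy.1 hy.2).ne'

lemma continuousOn_sqCotSub : ContinuousOn sqCotSub (Ico 0 π) :=
  (continuousOn_id.mul continuousOn_mulCot).sub continuousOn_id

lemma measurable_sinc : Measurable sinc := continuous_sinc.measurable

lemma measurable_mulLogSinc : Measurable mulLogSinc :=
  measurable_id.mul (measurable_log.comp measurable_sinc)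

lemma measurable_mulCot : Measurable mulCot := measurable_cos.div measurable_sinc

lemma hasDerivAt_log_sinc {y : ℝ} (h0 : 0 < y) (hpi : y < π) :
    HasDerivAt (fun y => log (sinc y)) (cos y / sin y - 1 / y) y := by
  have hs := sin_pos_of_pos_of_lt_pi h0 hpi
  have h1 : HasDerivAt (fun y => log (sin y) - log y) (cos y / sin y - 1 / y) y := by
    have := ((hasDerivAt_sin y).log hs.ne').sub ((hasDerivAt_id y).log h0.ne')
    simpa using! this
  refine h1.congr_of_eventuallyEq ?_
  filter_upwards [Ioo_mem_nhds h0 hpi] with z hz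
  rw [sinc_of_ne_zero hz.1.ne', log_div (sin_pos_of_pos_of_lt_pi hz.1 hz.2).ne' hz.1.ne']

lemma hasDerivAt_mulCot {y : ℝ} (h0 : 0 < y) (hpi : y < π) :
    HasDerivAt mulCot (cos y / sin y - y / sin y ^ 2) y := by
  have hs := sin_pos_of_pos_of_lt_pi h0 hpi
  have h1 : HasDerivAt (fun y => y * cos y / sin y) (cos y / sin y - y / sin y ^ 2) y := by
    have := ((hasDerivAt_id y).mul (hasDerivAt_cos y)).div (hasDerivAt_sin y) hs.ne'
    refine this.congr_deriv ?_
    simp only [id_eq, Pi.mul_apply]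
    field_simp
    linear_combination (-y) * sin_sq_add_cos_sq y
  refine h1.congr_of_eventuallyEq ?_
  filter_upwards [Ioo_mem_nhds h0 hpi] with z hz
  exact mulCot_of_ne_zero hz.1.ne'

lemma hasDerivAt_mulLogSinc {y : ℝ} (h0 : 0 < y) (hpi : y < π) :
    HasDerivAt mulLogSinc (log (sinc y) + mulCot y - 1) y := by
  refine ((hasDerivAt_id y).mul (hasDerivAt_log_sinc h0 hpi)).congr_deriv ?_
  rw [mulCot_of_ne_zero h0.ne']
  simp only [id_eq]
  field_simp
  ring

lemma hasDerivAt_sqCotSub {y : ℝ} (h0 : 0 < y) (hpi : y < π) :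
    HasDerivAt sqCotSub (2 * y * cos y / sin y - y ^ 2 / sin y ^ 2 - 1) y := by
  have hs := sin_pos_of_pos_of_lt_pi h0 hpi
  refine (((hasDerivAt_id y).mul (hasDerivAt_mulCot h0 hpi)).sub (hasDerivAt_id y)).congr_deriv ?_
  rw [mulCot_of_ne_zero h0.ne']
  simp only [id_eq]
  field_simp
  ring

lemma antitoneOn_mulCot : AntitoneOn mulCot (Ico 0 π) := by
  refine antitoneOn_of_hasDerivWithinAt_nonpos (f' := fun y => cos y / sin y - y / sin y ^ 2)
    (convex_Ico 0 π) continuousOn_mulCot ?_ ?_ <;> simp only [interior_Ico]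
  · exact fun y hy => (hasDerivAt_mulCot hy.1 hy.2).hasDerivWithinAt
  · intro y hy
    have hs := sin_pos_of_pos_of_lt_pi hy.1 hy.2
    have h1 : sin (2 * y) ≤ 2 * y := sin_le (by linarith [hy.1])
    rw [sin_two_mul] at h1
    rw [sub_nonpos, div_le_div_iff₀ hs (by positivity)]
    nlinarith

lemma mulCot_le_one {y : ℝ} (h0 : 0 ≤ y) (hpi : y < π) : mulCot y ≤ 1 := by
  rw [← mulCot_zero]
  exact antitoneOn_mulCot ⟨le_rfl, pi_pos⟩ ⟨h0, hpi⟩ h0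

lemma mul_cos_le_sin {y : ℝ} (h0 : 0 < y) (hpi : y < π) : y * cos y ≤ sin y := by
  have := mulCot_le_one h0.le hpi
  rwa [mulCot_of_ne_zero h0.ne', div_le_one (sin_pos_of_pos_of_lt_pi h0 hpi)] at this

lemma antitoneOn_log_sinc : AntitoneOn (fun y => log (sinc y)) (Ico 0 π) := by
  refine antitoneOn_of_hasDerivWithinAt_nonpos (f' := fun y => cos y / sin y - 1 / y)
    (convex_Ico 0 π) continuousOn_log_sinc ?_ ?_ <;> simp only [interior_Ico]
  · exact fun y hy => (hasDerivAt_log_sinc hy.1 hy.2).hasDerivWithinAt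
  · intro y hy
    have hs := sin_pos_of_pos_of_lt_pi hy.1 hy.2
    rw [sub_nonpos, div_le_div_iff₀ hs hy.1]
    linarith [mul_cos_le_sin hy.1 hy.2]

/-- The second derivative is minus a sum of squares over `y * sin y ^ 2`. This concavity yields the
monotonicity of `logKanter a u` in `a`. -/
lemma concaveOn_mulLogSinc : ConcaveOn ℝ (Ico 0 π) mulLogSinc := by
  refine concaveOn_of_hasDerivWithinAt2_nonpos
    (f' := fun y => log (sinc y) + mulCot y - 1)
    (f'' := fun y => (cos y / sin y - 1 / y) + (cos y / sin y - y / sin y ^ 2))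
    (convex_Ico 0 π) continuousOn_mulLogSinc ?_ ?_ ?_ <;> simp only [interior_Ico]
  · exact fun y hy => (hasDerivAt_mulLogSinc hy.1 hy.2).hasDerivWithinAt
  · exact fun y hy => (((hasDerivAt_log_sinc hy.1 hy.2).add
      (hasDerivAt_mulCot hy.1 hy.2)).sub_const 1).hasDerivWithinAt
  · intro y hy
    have hs := sin_pos_of_pos_of_lt_pi hy.1 hy.2
    have hy0 := hy.1
    have h : (cos y / sin y - 1 / y) + (cos y / sin y - y / sin y ^ 2) =
        -((y - sin y * cos y) ^ 2 + sin y ^ 4) / (y * sin y ^ 2) := by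
      field_simp
      linear_combination (sin y ^ 2) * sin_sq_add_cos_sq y
    rw [h]
    have h4 : 0 ≤ (y - sin y * cos y) ^ 2 + sin y ^ 4 := by positivity
    exact div_nonpos_of_nonpos_of_nonneg (by linarith) (by positivity)

/-- The sign of the second derivative reduces to `y * cos y ≤ sin y ≤ y`. The function `sqCotSub`
matters because its difference quotients appear in the `u`-derivative of `logKanter a`. -/
lemma concaveOn_sqCotSub : ConcaveOn ℝ (Ico 0 π) sqCotSub := by
  refine concaveOn_of_hasDerivWithinAt2_nonpos
    (f' := fun y => 2 * y * cos y / sin y - y ^ 2 / sin y ^ 2 - 1)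
    (f'' := fun y => 2 * (cos y * (sin y ^ 2 + y ^ 2) - 2 * y * sin y) / sin y ^ 3)
    (convex_Ico 0 π) continuousOn_sqCotSub ?_ ?_ ?_ <;> simp only [interior_Ico]
  · exact fun y hy => (hasDerivAt_sqCotSub hy.1 hy.2).hasDerivWithinAt
  · intro y hy
    have hs := sin_pos_of_pos_of_lt_pi hy.1 hy.2
    have h1 := (((hasDerivAt_id y).const_mul 2).mul (hasDerivAt_cos y)).div
      (hasDerivAt_sin y) hs.ne'
    have h2 := ((hasDerivAt_id y).pow 2).div ((hasDerivAt_sin y).pow 2) (pow_pos hs 2).ne'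
    refine ((h1.sub h2).sub_const 1).hasDerivWithinAt.congr_deriv ?_
    simp only [id_eq, Pi.mul_apply, Pi.pow_apply]
    field_simp
    linear_combination (-2 * y * sin y ^ 2) * sin_sq_add_cos_sq y
  · intro y hy
    have hs := sin_pos_of_pos_of_lt_pi hy.1 hy.2
    have hy0 := hy.1
    refine div_nonpos_of_nonpos_of_nonneg ?_ (by positivity)
    have h1 := mul_cos_le_sin hy.1 hy.2
    have h2 := sin_le hy0.le
    rcases le_total (cos y) 0 with hc | hc
    · nlinarith [mul_pos hy0 hs, mul_nonneg (neg_nonneg.2 hc) (add_nonneg (sq_nonneg (sin y))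
        (sq_nonneg y))]
    · have h3 : cos y * sin y ^ 2 ≤ y * sin y := by
        have : cos y * sin y ^ 2 ≤ 1 * sin y ^ 2 := by gcongr; exact cos_le_one y
        nlinarith
      nlinarith

/-! ### Kanter's function: monotonicity in the parameter and in the angle. -/

/-- The logarithm of Kanter's function, normalized to vanish at `0`. -/
def logKanter (a u : ℝ) : ℝ :=
  (mulLogSinc u - mulLogSinc (a * u)) / (u - a * u) - log (sinc ((1 - a) * u))

/-- The limit of `logKanter a` as `a → 1`. -/
def logKanterOne (u : ℝ) : ℝ := log (sinc u) + mulCot u - 1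

lemma measurable_logKanter (a : ℝ) : Measurable (logKanter a) := by
  have h1 : Measurable fun u : ℝ => mulLogSinc (a * u) :=
    measurable_mulLogSinc.comp (measurable_const_mul a)
  have h2 : Measurable fun u : ℝ => log (sinc ((1 - a) * u)) :=
    measurable_log.comp (measurable_sinc.comp (measurable_const_mul _))
  exact ((measurable_mulLogSinc.sub h1).div (measurable_id.sub (measurable_const_mul a))).sub h2

lemma measurable_logKanterOne : Measurable logKanterOne :=
  ((measurable_log.comp measurable_sinc).add measurable_mulCot).sub_const 1

lemma logKanter_zero {u : ℝ} (hu : u ≠ 0) : logKanter 0 u = 0 := by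
  simp [logKanter, mulLogSinc, hu]

lemma one_sub_mul_logKanter {a u : ℝ} (ha : a < 1) (hu : u ≠ 0) :
    (1 - a) * logKanter a u =
      log (sinc u) - a * log (sinc (a * u)) - (1 - a) * log (sinc ((1 - a) * u)) := by
  have h1 : 1 - a ≠ 0 := by linarith
  have h2 : u - a * u = (1 - a) * u := by ring
  rw [logKanter, mulLogSinc, mulLogSinc, h2]
  field_simp

lemma mul_mem_Ico {a u : ℝ} (h0 : 0 ≤ a) (h1 : a ≤ 1) (hu : u ∈ Ioo 0 π) : a * u ∈ Ico 0 π :=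
  ⟨mul_nonneg h0 hu.1.le, by nlinarith [hu.1, hu.2]⟩

lemma slope_le_of_concaveOn {f : ℝ → ℝ} (hf : ConcaveOn ℝ (Ico 0 π) f) {a b u : ℝ} (hb : 0 ≤ b)
    (hba : b ≤ a) (ha : a < 1) (hu : u ∈ Ioo 0 π) :
    (f u - f (a * u)) / (u - a * u) ≤ (f u - f (b * u)) / (u - b * u) := by
  have key := hf.slope_anti (x := u) ⟨hu.1.le, hu.2⟩
    (a := b * u) ⟨mul_mem_Ico hb (by linarith) hu, by
      simp only [mem_singleton_iff]; nlinarith [hu.1]⟩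
    (b := a * u) ⟨mul_mem_Ico (by linarith) ha.le hu, by
      simp only [mem_singleton_iff]; nlinarith [hu.1]⟩ (by nlinarith [hu.1])
  rwa [slope_comm f u, slope_comm f u, slope_def_field, slope_def_field] at key

/-- Chords of a concave function with right end fixed at `u` get less steep as the left end `a * u`
moves right, while the subtracted `log (sinc ((1 - a) * u))` grows. -/
lemma logKanter_anti {a b u : ℝ} (hb : 0 ≤ b) (hba : b ≤ a) (ha : a < 1) (hu : u ∈ Ioo 0 π) :
    logKanter a u ≤ logKanter b u := by
  refine sub_le_sub (slope_le_of_concaveOn concaveOn_mulLogSinc hb hba ha hu) ?_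
  exact antitoneOn_log_sinc (mul_mem_Ico (by linarith) (by linarith) hu)
    (mul_mem_Ico (by linarith) (by linarith) hu) (by nlinarith [hu.1])

lemma logKanter_nonpos {a u : ℝ} (ha0 : 0 ≤ a) (ha : a < 1) (hu : u ∈ Ioo 0 π) :
    logKanter a u ≤ 0 := by
  rw [← logKanter_zero hu.1.ne']
  exact logKanter_anti le_rfl ha0 ha hu

lemma tendsto_mul_nhdsNE {u : ℝ} (hu : 0 < u) :
    Tendsto (fun a : ℝ => a * u) (𝓝[<] 1) (𝓝[≠] u) := by
  refine tendsto_nhdsWithin_iff.2 ⟨?_, ?_⟩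
  · have : Tendsto (fun a : ℝ => a * u) (𝓝 1) (𝓝 (1 * u)) :=
      (continuous_id.mul continuous_const).tendsto 1
    rw [one_mul] at this
    exact this.mono_left nhdsWithin_le_nhds
  · filter_upwards [self_mem_nhdsWithin] with a ha
    have : a < 1 := ha
    exact (show a * u < u by nlinarith).ne

lemma tendsto_slope_one {f : ℝ → ℝ} {f' u : ℝ} (hu : 0 < u) (hf : HasDerivAt f f' u) :
    Tendsto (fun a : ℝ => (f u - f (a * u)) / (u - a * u)) (𝓝[<] 1) (𝓝 f') := by
  refine ((hasDerivAt_iff_tendsto_slope.1 hf).comp (tendsto_mul_nhdsNE hu)).congr fun a => ?_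
  rw [Function.comp_apply, slope_comm, slope_def_field]

lemma tendsto_logKanter {u : ℝ} (hu : u ∈ Ioo 0 π) :
    Tendsto (fun a => logKanter a u) (𝓝[<] 1) (𝓝 (logKanterOne u)) := by
  have h1 := tendsto_slope_one hu.1 (hasDerivAt_mulLogSinc hu.1 hu.2)
  have h2 : ContinuousAt (fun a : ℝ => log (sinc ((1 - a) * u))) 1 :=
    ContinuousAt.log (continuous_sinc.comp (by fun_prop)).continuousAt (by simp)
  have h3 := h1.sub (h2.tendsto.mono_left nhdsWithin_le_nhds)
  simpa using! h3

lemma logKanterOne_le {a u : ℝ} (ha0 : 0 ≤ a) (ha : a < 1) (hu : u ∈ Ioo 0 π) :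
    logKanterOne u ≤ logKanter a u := by
  refine le_of_tendsto (tendsto_logKanter hu) ?_
  filter_upwards [Ioo_mem_nhdsLT ha] with b hb
  exact logKanter_anti ha0 hb.1.le hb.2 hu

lemma logKanterOne_nonpos {u : ℝ} (hu : u ∈ Ioo 0 π) : logKanterOne u ≤ 0 :=
  (logKanterOne_le le_rfl zero_lt_one hu).trans_eq (logKanter_zero hu.1.ne')

lemma hasDerivAt_logKanter {a u : ℝ} (ha0 : 0 ≤ a) (ha : a < 1) (hu : u ∈ Ioo 0 π) :
    HasDerivAt (logKanter a)
      (((sqCotSub u - sqCotSub (a * u)) / (u - a * u) - (mulCot ((1 - a) * u) - 1)) / u) u := by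
  have hu0 := hu.1
  have h1a : 0 < 1 - a := by linarith
  have hsub : u - a * u = (1 - a) * u := by ring
  have hb := mul_mem_Ico h1a.le (by linarith) hu
  have hb0 : 0 < (1 - a) * u := mul_pos h1a hu0
  have hlin : ∀ c : ℝ, HasDerivAt (fun u : ℝ => c * u) c u := fun c => by
    simpa using (hasDerivAt_id u).const_mul c
  have hA : HasDerivAt (fun u => mulLogSinc (a * u))
      (a * (log (sinc (a * u)) + mulCot (a * u) - 1)) u := by
    rcases ha0.eq_or_lt with rfl | hpos
    · simpa [mulLogSinc] using hasDerivAt_const u (0 : ℝ)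
    · have := (hasDerivAt_mulLogSinc (mul_pos hpos hu0) (mul_mem_Ico ha0 ha.le hu).2).comp u
        (hlin a)
      exact this.congr_deriv (by ring)
  have hB : HasDerivAt (fun u => log (sinc ((1 - a) * u)))
      ((cos ((1 - a) * u) / sin ((1 - a) * u) - 1 / ((1 - a) * u)) * (1 - a)) u :=
    (hasDerivAt_log_sinc hb0 hb.2).comp u (hlin _)
  have hC : HasDerivAt (fun u => u - a * u) (1 - a) u := (hasDerivAt_id u).sub (hlin a)
  have := (((hasDerivAt_mulLogSinc hu.1 hu.2).sub hA).div hC (by rw [hsub]; exact hb0.ne')).sub hB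
  refine this.congr_deriv ?_
  have hs := sin_pos_of_pos_of_lt_pi hb0 hb.2
  rw [mulCot_of_ne_zero hb0.ne']
  simp only [sqCotSub, Pi.sub_apply, mulLogSinc, hsub]
  field_simp
  ring

lemma antitoneOn_of_hasDerivAt_Ioo {f f' : ℝ → ℝ} (hf : ∀ u ∈ Ioo 0 π, HasDerivAt f (f' u) u)
    (hf' : ∀ u ∈ Ioo 0 π, f' u ≤ 0) : AntitoneOn f (Ioo 0 π) := by
  refine antitoneOn_of_hasDerivWithinAt_nonpos (f' := f') (convex_Ioo 0 π)
    (fun u hu => (hf u hu).continuousAt.continuousWithinAt) ?_ ?_ <;> rw [interior_Ioo]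
  · exact fun u hu => (hf u hu).hasDerivWithinAt
  · exact hf'

/-- The derivative of `logKanter a` is again a chord slope of a concave function minus a monotone
term, so it decreases in `a`. This is the source of the single crossing. -/
lemma antitoneOn_logKanter_sub {a b : ℝ} (hb : 0 ≤ b) (hba : b ≤ a) (ha : a < 1) :
    AntitoneOn (fun u => logKanter a u - logKanter b u) (Ioo 0 π) := by
  refine antitoneOn_of_hasDerivAt_Ioo (fun u hu => (hasDerivAt_logKanter (hb.trans hba) ha hu).sub
    (hasDerivAt_logKanter hb (hba.trans_lt ha) hu)) fun u hu => ?_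
  have h1 := slope_le_of_concaveOn concaveOn_sqCotSub hb hba ha hu
  have h2 := antitoneOn_mulCot (mul_mem_Ico (a := 1 - a) (by linarith) (by linarith) hu)
    (mul_mem_Ico (a := 1 - b) (by linarith) (by linarith) hu) (by nlinarith [hu.1])
  rw [← sub_div]
  exact div_nonpos_of_nonpos_of_nonneg (by linarith) hu.1.le

lemma antitoneOn_logKanter {a : ℝ} (ha0 : 0 ≤ a) (ha : a < 1) :
    AntitoneOn (logKanter a) (Ioo 0 π) := by
  refine (antitoneOn_logKanter_sub le_rfl ha0 ha).congr fun u hu => ?_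
  simp [logKanter_zero hu.1.ne']

lemma antitoneOn_logKanterOne_sub {a : ℝ} (ha0 : 0 ≤ a) (ha : a < 1) :
    AntitoneOn (fun u => logKanterOne u - logKanter a u) (Ioo 0 π) := by
  intro u hu v hv huv
  refine le_of_tendsto_of_tendsto ((tendsto_logKanter hv).sub_const (logKanter a v))
    ((tendsto_logKanter hu).sub_const (logKanter a u)) ?_
  filter_upwards [Ioo_mem_nhdsLT ha] with b hb
  exact antitoneOn_logKanter_sub ha0 hb.1.le hb.2 hu hv huv

lemma tendsto_logKanterOne_zero : Tendsto logKanterOne (𝓝[>] 0) (𝓝 0) := by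
  have h : ContinuousWithinAt logKanterOne (Ico 0 π) 0 :=
    ((continuousOn_log_sinc.add continuousOn_mulCot).sub continuousOn_const) 0 ⟨le_rfl, pi_pos⟩
  have h' : Tendsto logKanterOne (𝓝[Ico 0 π] 0) (𝓝 (logKanterOne 0)) := h
  have h0 : logKanterOne 0 = 0 := by simp [logKanterOne, mulCot_zero]
  rw [h0] at h'
  refine h'.mono_left ?_
  rw [← nhdsWithin_Ioo_eq_nhdsGT pi_pos]
  exact nhdsWithin_mono _ Ioo_subset_Ico_self

end

/-! ### Binomial coefficients as integrals along a steepest descent path. -/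

noncomputable section

/-- The binomial coefficient `n` over `a` for a real number `a`. -/
def realChoose (n : ℕ) (a : ℝ) : ℝ := n.factorial / (Gamma (1 + a) * Gamma (1 + n - a))

/-- Valid at the poles too: `Gamma` takes the value `0` there, so its inverse agrees with the entire
function `1 / Γ`. -/
lemma inv_Gamma_eq (a : ℝ) : (Gamma a)⁻¹ = a * (Gamma (1 + a))⁻¹ := by
  rcases eq_or_ne a 0 with rfl | h
  · simp
  · rw [add_comm, Gamma_add_one h, mul_inv, mul_inv_cancel_left₀ h]

lemma realChoose_zero {a : ℝ} (ha : a ≠ 0) : π * realChoose 0 a = sin (π * a) / a := by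
  have h := congrArg (·⁻¹) (Gamma_mul_Gamma_one_sub a)
  simp only [mul_inv, inv_Gamma_eq a, inv_div] at h
  have h1 : (Gamma (1 + a))⁻¹ * (Gamma (1 - a))⁻¹ = sin (π * a) / π / a := by
    rw [← h]; field_simp
  have h2 : realChoose 0 a = (Gamma (1 + a))⁻¹ * (Gamma (1 - a))⁻¹ := by
    simp [realChoose, div_eq_mul_inv, mul_comm]
  rw [h2, h1]
  field_simp

lemma realChoose_succ (n : ℕ) (a : ℝ) :
    realChoose (n + 1) a = realChoose n a + realChoose n (a - 1) := by
  have h1 := inv_Gamma_eq a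
  have h2 := inv_Gamma_eq (1 + n - a)
  have e1 : 1 + ((n + 1 : ℕ) : ℝ) - a = 1 + (1 + n - a) := by push_cast; ring
  have e2 : 1 + (n : ℝ) - (a - 1) = 1 + (1 + n - a) := by ring
  have e3 : 1 + (a - 1) = a := by ring
  simp only [realChoose, e1, e2, e3, div_eq_mul_inv, mul_inv, h1, h2, Nat.factorial_succ]
  push_cast
  ring

/-- In the variable `w = log z` the integrand is entire, so a primitive replaces contour
deformation. Induction on `n` by Pascal's rule; the base case is the reflection formula for Gamma.
-/
lemma exists_primitive (n : ℕ) : ∀ a : ℝ, ∃ Φ : ℂ → ℂ,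
    (∀ w, HasDerivAt Φ ((1 + Complex.exp w) ^ n * Complex.exp (-(a * w))) w) ∧
    (∀ x : ℝ, (Φ x).im = 0) ∧ (Φ (π * Complex.I)).im = π * realChoose n a := by
  induction n with
  | zero =>
    intro a
    rcases eq_or_ne a 0 with rfl | ha
    · exact ⟨id, fun w => by simpa using hasDerivAt_id w, fun x => by simp,
        by simp [realChoose]⟩
    · have hac : (a : ℂ) ≠ 0 := by exact_mod_cast ha
      refine ⟨fun w => -(a : ℂ)⁻¹ * Complex.exp (-(a * w)), fun w => ?_, fun x => ?_, ?_⟩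
      · have h1 : HasDerivAt (fun w : ℂ => -((a : ℂ) * w)) (-(a : ℂ)) w := by
          simpa using! ((hasDerivAt_id w).const_mul (a : ℂ)).neg
        refine (h1.cexp.const_mul (-(a : ℂ)⁻¹)).congr_deriv ?_
        field_simp
      · have : -(a : ℂ)⁻¹ * Complex.exp (-(a * x)) = ((-a⁻¹ * exp (-(a * x)) : ℝ) : ℂ) := by
          push_cast; ring
        simp only [this, Complex.ofReal_im]
      · rw [realChoose_zero ha]
        have : -(a : ℂ)⁻¹ * Complex.exp (-(a * (π * Complex.I))) =
            ((-a⁻¹ : ℝ) : ℂ) * Complex.exp ((-(π * a) : ℝ) * Complex.I) := by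
          push_cast; ring_nf
        simp only [this]
        rw [Complex.im_ofReal_mul, Complex.exp_ofReal_mul_I_im, sin_neg]
        field_simp
  | succ n ih =>
    intro a
    obtain ⟨Φ, h1, h2, h3⟩ := ih a
    obtain ⟨Ψ, k1, k2, k3⟩ := ih (a - 1)
    refine ⟨fun w => Φ w + Ψ w, fun w => ((h1 w).add (k1 w)).congr_deriv ?_, fun x => ?_, ?_⟩
    · have : Complex.exp (-((a - 1 : ℝ) * w)) = Complex.exp (-(a * w)) * Complex.exp w := by
        rw [← Complex.exp_add]; push_cast; ring_nf
      rw [this]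
      ring
    · simp [h2, k2]
    · rw [Complex.add_im, h3, k3, realChoose_succ]
      ring

variable {a : ℝ}

/-- The modulus of the steepest descent path for `(1 + z) z ^ (-a)` in the direction `u`. -/
def pathRadius (a u : ℝ) : ℝ := a * sinc (a * u) / ((1 - a) * sinc ((1 - a) * u))

lemma mul_mem_Ico_of_Icc (h0 : 0 ≤ a) (h1 : a < 1) {u : ℝ} (hu : u ∈ Icc 0 π) :
    a * u ∈ Ico 0 π :=
  ⟨mul_nonneg h0 hu.1, by nlinarith [hu.1, hu.2, pi_pos]⟩

lemma pathRadius_pos (h0 : 0 < a) (h1 : a < 1) {u : ℝ} (hu : u ∈ Icc 0 π) :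
    0 < pathRadius a u := by
  have h2 := mul_mem_Ico_of_Icc h0.le h1 hu
  have h3 := mul_mem_Ico_of_Icc (a := 1 - a) (by linarith) (by linarith) hu
  exact div_pos (mul_pos h0 (sinc_pos h2.1 h2.2)) (mul_pos (by linarith) (sinc_pos h3.1 h3.2))

lemma continuousOn_pathRadius (h1 : a < 1) (h0 : 0 < a) :
    ContinuousOn (pathRadius a) (Icc 0 π) := by
  refine ContinuousOn.div (by fun_prop) (by fun_prop) fun u hu => ?_
  have h3 := mul_mem_Ico_of_Icc (a := 1 - a) (by linarith) (by linarith) hu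
  exact (mul_pos (by linarith) (sinc_pos h3.1 h3.2)).ne'

lemma pathRadius_of_ne_zero (h0 : a ≠ 0) (h1 : 1 - a ≠ 0) {u : ℝ} (hu : u ≠ 0) :
    pathRadius a u = sin (a * u) / sin ((1 - a) * u) := by
  rw [pathRadius, sinc_of_ne_zero (mul_ne_zero h0 hu), sinc_of_ne_zero (mul_ne_zero h1 hu)]
  field_simp

lemma pathRadius_pi (h0 : 0 < a) (h1 : a < 1) : pathRadius a π = 1 := by
  have h2 : (1 - a) * π = π - a * π := by ring
  rw [pathRadius_of_ne_zero h0.ne' (by linarith) pi_ne_zero, h2, sin_pi_sub, div_self]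
  exact (sin_pos_of_pos_of_lt_pi (by positivity) (by nlinarith [pi_pos])).ne'

/-- The modulus of `(1 + z) z ^ (-a)` along the steepest descent path. -/
def pathModulus (a u : ℝ) : ℝ :=
  exp ((1 - a) * logKanter a u - (a * log a + (1 - a) * log (1 - a)))

lemma log_sinc_mul {c u : ℝ} (hc : 0 < c) (hc1 : c ≤ 1) (hu : u ∈ Ioo 0 π) :
    log (sinc (c * u)) = log (sin (c * u)) - log c - log u := by
  have hu0 := hu.1
  have hs : 0 < sin (c * u) := sin_pos_of_pos_of_lt_pi (by positivity) (mul_mem_Ico hc.le hc1 hu).2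
  rw [sinc_of_ne_zero (by positivity), log_div hs.ne' (by positivity),
    log_mul hc.ne' hu0.ne']
  ring

lemma pathModulus_eq (h0 : 0 < a) (h1 : a < 1) {u : ℝ} (hu : u ∈ Ioo 0 π) :
    pathModulus a u =
      sin u / sin ((1 - a) * u) * exp (-(a * log (pathRadius a u))) := by
  have hu0 := hu.1
  have hs := sin_pos_of_pos_of_lt_pi hu.1 hu.2
  have ha : 0 < sin (a * u) :=
    sin_pos_of_pos_of_lt_pi (by positivity) (mul_mem_Ico h0.le h1.le hu).2
  have hb : 0 < sin ((1 - a) * u) :=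
    sin_pos_of_pos_of_lt_pi (mul_pos (by linarith) hu0)
      (mul_mem_Ico (by linarith) (by linarith) hu).2
  have h2 := log_sinc_mul zero_lt_one le_rfl hu
  simp only [one_mul, log_one, sub_zero] at h2
  rw [pathRadius_of_ne_zero h0.ne' (by linarith) hu0.ne', log_div ha.ne' hb.ne',
    ← exp_log (div_pos hs hb), ← exp_add, log_div hs.ne' hb.ne', pathModulus,
    one_sub_mul_logKanter h1 hu0.ne', log_sinc_mul h0 h1.le hu,
    log_sinc_mul (by linarith) (by linarith) hu, h2]
  congr 1
  ring

/-- The radius is chosen exactly so that `1 + z` has argument `a * u` when `z` has argument `u`; the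
phases in `(1 + z) * z ^ (-a)` then cancel. -/
lemma one_add_path (h0 : 0 < a) (h1 : a < 1) {u : ℝ} (hu : u ∈ Ioo 0 π) :
    1 + (pathRadius a u : ℂ) * Complex.exp (u * Complex.I) =
      ((sin u / sin ((1 - a) * u) : ℝ) : ℂ) * Complex.exp ((a * u : ℝ) * Complex.I) := by
  have hb : 0 < sin ((1 - a) * u) :=
    sin_pos_of_pos_of_lt_pi (mul_pos (by linarith) hu.1)
      (mul_mem_Ico (by linarith) (by linarith) hu).2
  rw [pathRadius_of_ne_zero h0.ne' (by linarith) hu.1.ne']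
  have h2 : sin ((1 - a) * u) = sin u * cos (a * u) - cos u * sin (a * u) := by
    rw [← sin_sub]; ring_nf
  set s := sin ((1 - a) * u)
  apply Complex.ext
  · rw [Complex.add_re, Complex.re_ofReal_mul, Complex.re_ofReal_mul, Complex.exp_ofReal_mul_I_re,
      Complex.exp_ofReal_mul_I_re, Complex.one_re]
    field_simp
    linarith
  · rw [Complex.add_im, Complex.im_ofReal_mul, Complex.im_ofReal_mul, Complex.exp_ofReal_mul_I_im,
      Complex.exp_ofReal_mul_I_im, Complex.one_im]
    field_simp
    ring

lemma integrand_path (h0 : 0 < a) (h1 : a < 1) (n : ℕ) {u : ℝ} (hu : u ∈ Ioo 0 π) :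
    (1 + Complex.exp (log (pathRadius a u) + u * Complex.I)) ^ n *
      Complex.exp (-((a * n : ℝ) * (log (pathRadius a u) + u * Complex.I))) =
      ((pathModulus a u ^ n : ℝ) : ℂ) := by
  have hr := pathRadius_pos h0 h1 (Ioo_subset_Icc_self hu)
  have e1 : Complex.exp (log (pathRadius a u) + u * Complex.I) =
      (pathRadius a u : ℂ) * Complex.exp (u * Complex.I) := by
    rw [Complex.exp_add, ← Complex.ofReal_exp, exp_log hr]
  have e2 : Complex.exp (-((a * n : ℝ) * (log (pathRadius a u) + u * Complex.I))) =
      (((exp (-(a * log (pathRadius a u))) : ℝ) : ℂ) *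
        Complex.exp (-((a * u : ℝ) * Complex.I))) ^ n := by
    rw [Complex.ofReal_exp, ← Complex.exp_add, ← Complex.exp_nat_mul]
    push_cast
    ring_nf
  rw [e1, e2, one_add_path h0 h1 hu, ← mul_pow, pathModulus_eq h0 h1 hu, Complex.ofReal_pow,
    Complex.ofReal_mul (sin u / _)]
  congr 1
  generalize ((a * u : ℝ) : ℂ) = θ
  have : Complex.exp (θ * Complex.I) * Complex.exp (-(θ * Complex.I)) = 1 := by
    rw [← Complex.exp_add, add_neg_cancel, Complex.exp_zero]
  linear_combination (((sin u / sin ((1 - a) * u) : ℝ) : ℂ) *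
    ((exp (-(a * log (pathRadius a u))) : ℝ) : ℂ)) * this

lemma differentiableAt_log_pathRadius (h0 : 0 < a) (h1 : a < 1) {u : ℝ} (hu : u ∈ Ioo 0 π) :
    DifferentiableAt ℝ (fun u => log (pathRadius a u)) u := by
  have hb : 0 < sin ((1 - a) * u) :=
    sin_pos_of_pos_of_lt_pi (mul_pos (by linarith) hu.1)
      (mul_mem_Ico (by linarith) (by linarith) hu).2
  have h2 : DifferentiableAt ℝ (pathRadius a) u := by
    have : DifferentiableAt ℝ (fun u => sin (a * u) / sin ((1 - a) * u)) u :=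
      DifferentiableAt.div (by fun_prop) (by fun_prop) hb.ne'
    refine this.congr_of_eventuallyEq ?_
    filter_upwards [Ioo_mem_nhds hu.1 hu.2] with v hv
    exact pathRadius_of_ne_zero h0.ne' (by linarith) hv.1.ne'
  exact h2.log (pathRadius_pos h0 h1 (Ioo_subset_Icc_self hu)).ne'

lemma measurable_pathModulus (a : ℝ) : Measurable (pathModulus a) :=
  measurable_exp.comp (((measurable_logKanter a).const_mul _).sub_const _)

lemma pathModulus_le (h0 : 0 < a) (h1 : a < 1) {u : ℝ} (hu : u ∈ Ioo 0 π) :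
    pathModulus a u ≤ exp (-(a * log a + (1 - a) * log (1 - a))) := by
  refine exp_le_exp.2 ?_
  nlinarith [logKanter_nonpos h0.le h1 hu]

/-- The path in `w` runs from a real point to `π * I`, and its imaginary part is `u`. As the
integrand is real along it, the imaginary part of the primitive has `u`-derivative exactly
`pathModulus a u ^ n`. -/
lemma integral_pathModulus_pow (h0 : 0 < a) (h1 : a < 1) (n : ℕ) :
    ∫ u in (0 : ℝ)..π, pathModulus a u ^ n = π * realChoose n (a * n) := by
  obtain ⟨Φ, hΦ, hre, hpi⟩ := exists_primitive n (a * n)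
  have hcont : Continuous Φ := continuous_iff_continuousAt.2 fun w => (hΦ w).continuousAt
  have key := intervalIntegral.integral_eq_sub_of_hasDerivAt_of_le
    (f := fun u : ℝ => (Φ (log (pathRadius a u) + u * Complex.I)).im)
    (f' := fun u => pathModulus a u ^ n) pi_pos.le ?_ ?_ ?_
  · rw [key, pathRadius_pi h0 h1]
    have h2 := hre (log (pathRadius a 0))
    simp [hpi, h2]
  · refine Complex.continuous_im.comp_continuousOn (hcont.comp_continuousOn ?_)
    refine ContinuousOn.add (Complex.continuous_ofReal.comp_continuousOn ?_) (by fun_prop)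
    exact (continuousOn_pathRadius h1 h0).log fun u hu => (pathRadius_pos h0 h1 hu).ne'
  · intro u hu
    have hw := (differentiableAt_log_pathRadius h0 h1 hu).hasDerivAt.ofReal_comp.add
      (((hasDerivAt_id u).ofReal_comp).mul_const Complex.I)
    have h2 := (hΦ _).comp u hw
    have h3 := Complex.imCLM.hasFDerivAt.comp_hasDerivAt u h2
    refine h3.congr_deriv ?_
    simp only [Pi.add_apply, id_eq]
    rw [integrand_path h0 h1 n hu]
    simp only [Complex.imCLM_apply, Complex.im_ofReal_mul]
    simp
  · rw [intervalIntegrable_iff_integrableOn_Ioo_of_le pi_pos.le]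
    refine Measure.integrableOn_of_bounded (s_finite := by simp)
      (M := exp (-(a * log a + (1 - a) * log (1 - a))) ^ n)
      ((measurable_pathModulus a).pow_const n).aestronglyMeasurable ?_
    filter_upwards [ae_restrict_mem measurableSet_Ioo] with u hu
    have hpos : 0 ≤ pathModulus a u := (exp_pos _).le
    rw [norm_of_nonneg (pow_nonneg hpos n)]
    exact pow_le_pow_left₀ (exp_pos _).le (pathModulus_le h0 h1 hu) n

end

/-! ### The base probability space and the moments of both sides. -/

noncomputable section

instance instIsProbabilityMeasureExpMeasureOne : IsProbabilityMeasure (expMeasure 1) :=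
  isProbabilityMeasure_expMeasure one_pos

/-- The uniform distribution on `(0, π)`. -/
def angleMeasure : Measure ℝ := (ENNReal.ofReal π)⁻¹ • volume.restrict (Ioo 0 π)

instance instIsProbabilityMeasureAngleMeasure : IsProbabilityMeasure angleMeasure := by
  constructor
  simp only [angleMeasure, Measure.smul_apply, Measure.restrict_apply_univ, Real.volume_Ioo,
    sub_zero, smul_eq_mul]
  exact ENNReal.inv_mul_cancel (by simp [pi_pos]) ENNReal.ofReal_ne_top

lemma ae_angleMeasure : ∀ᵐ u ∂angleMeasure, u ∈ Ioo 0 π :=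
  Measure.ae_smul_measure (ae_restrict_mem measurableSet_Ioo) _

lemma integral_angleMeasure (f : ℝ → ℝ) :
    ∫ u, f u ∂angleMeasure = π⁻¹ * ∫ u in (0 : ℝ)..π, f u := by
  rw [angleMeasure, integral_smul_measure, intervalIntegral.integral_of_le pi_pos.le,
    integral_Ioc_eq_integral_Ioo, ENNReal.toReal_inv, ENNReal.toReal_ofReal pi_pos.le, smul_eq_mul]

/-- The joint law of an exponential variable and an independent uniform angle. -/
def baseMeasure : Measure (ℝ × ℝ) := (expMeasure 1).prod angleMeasure

instance instIsProbabilityMeasureBaseMeasure : IsProbabilityMeasure baseMeasure := by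
  unfold baseMeasure; infer_instance

lemma lintegral_baseMeasure {f : ℝ × ℝ → ℝ≥0∞} (hf : Measurable f) :
    ∫⁻ p, f p ∂baseMeasure = ∫⁻ u, ∫⁻ l, f (l, u) ∂expMeasure 1 ∂angleMeasure :=
  lintegral_prod_symm _ hf.aemeasurable

lemma expMeasure_one_eq :
    expMeasure 1 = (volume.restrict (Ioi 0)).withDensity (fun x => ENNReal.ofReal (exp (-x))) := by
  have h : expMeasure 1 = volume.withDensity (exponentialPDF 1) := rfl
  rw [h, ← withDensity_indicator measurableSet_Ioi]
  refine withDensity_congr_ae ?_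
  filter_upwards [compl_mem_ae_iff.2 (measure_singleton (μ := volume) (0 : ℝ))] with x hx
  rw [exponentialPDF_eq]
  rcases lt_or_gt_of_ne (show x ≠ 0 from hx) with h | h
  · simp [not_le.2 h, h.le]
  · simp [h.le, h]

lemma lintegral_expMeasure_one {f : ℝ → ℝ≥0∞} (hf : Measurable f) :
    ∫⁻ x, f x ∂expMeasure 1 = ∫⁻ x in Ioi 0, ENNReal.ofReal (exp (-x)) * f x := by
  rw [expMeasure_one_eq, lintegral_withDensity_eq_lintegral_mul _ (by fun_prop) hf]
  rfl

lemma ae_expMeasure_one : ∀ᵐ x ∂expMeasure 1, 0 < x := by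
  rw [expMeasure_one_eq]
  exact (withDensity_absolutelyContinuous _ _).ae_le (ae_restrict_mem measurableSet_Ioi)

lemma ae_baseMeasure : ∀ᵐ p ∂baseMeasure, 0 < p.1 ∧ p.2 ∈ Ioo 0 π :=
  (Measure.quasiMeasurePreserving_fst.ae ae_expMeasure_one).and
    (Measure.quasiMeasurePreserving_snd.ae ae_angleMeasure)

lemma lintegral_rpow_expMeasure_one {s : ℝ} (hs : 0 ≤ s) :
    ∫⁻ x, ENNReal.ofReal (x ^ s) ∂expMeasure 1 = ENNReal.ofReal (Gamma (1 + s)) := by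
  rw [lintegral_expMeasure_one (by fun_prop), add_comm, Gamma_eq_integral (by linarith),
    ofReal_integral_eq_lintegral_ofReal (GammaIntegral_convergent (by linarith))]
  · refine setLIntegral_congr_fun measurableSet_Ioi fun x hx => ?_
    rw [← ENNReal.ofReal_mul (exp_pos _).le, add_sub_cancel_right]
  · filter_upwards [ae_restrict_mem measurableSet_Ioi] with x hx
    exact mul_nonneg (exp_pos _).le (rpow_nonneg (le_of_lt hx) _)

lemma lintegral_exp_half_expMeasure_one :
    ∫⁻ x, ENNReal.ofReal (exp (x / 2)) ∂expMeasure 1 < ∞ := by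
  rw [lintegral_expMeasure_one (by fun_prop)]
  have h : IntegrableOn (fun x : ℝ => exp (-(1 / 2) * x)) (Ioi 0) :=
    exp_neg_integrableOn_Ioi 0 (by norm_num)
  refine lt_of_eq_of_lt (setLIntegral_congr_fun measurableSet_Ioi fun x hx => ?_) h.lintegral_lt_top
  rw [← ENNReal.ofReal_mul (exp_pos _).le, ← exp_add]
  ring_nf

lemma expMeasure_one_Ioi {x : ℝ} (hx : 0 ≤ x) :
    expMeasure 1 (Ioi x) = ENNReal.ofReal (exp (-x)) := by
  have h := cdf_expMeasure_eq (r := 1) one_pos x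
  rw [if_pos hx, one_mul, cdf_eq_real] at h
  have h2 : (expMeasure 1).real (Ioi x) = exp (-x) := by
    rw [← compl_Iic, probReal_compl_eq_one_sub measurableSet_Iic, h]
    ring
  rw [← h2, ofReal_measureReal]

lemma integral_exp_logKanter {a : ℝ} (h0 : 0 < a) (h1 : a < 1) (n : ℕ) :
    ∫ u, exp (n * (1 - a) * logKanter a u) ∂angleMeasure =
      exp (n * (a * log a + (1 - a) * log (1 - a))) * realChoose n (a * n) := by
  have h : ∀ u, exp (n * (1 - a) * logKanter a u) =
      exp (n * (a * log a + (1 - a) * log (1 - a))) * pathModulus a u ^ n := fun u => by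
    rw [pathModulus, ← exp_nat_mul, ← exp_add]
    ring_nf
  simp_rw [h]
  rw [integral_const_mul, integral_angleMeasure, integral_pathModulus_pow h0 h1,
    inv_mul_cancel_left₀ pi_ne_zero]

lemma integrable_exp_mul_of_nonpos {g : ℝ → ℝ} (hg : Measurable g)
    (hle : ∀ u ∈ Ioo 0 π, g u ≤ 0) {s : ℝ} (hs : 0 ≤ s) :
    Integrable (fun u => exp (s * g u)) angleMeasure := by
  refine Integrable.of_bound (by fun_prop) 1 ?_
  filter_upwards [ae_angleMeasure] with u hu
  rw [norm_of_nonneg (exp_pos _).le, exp_le_one_iff]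
  exact mul_nonpos_of_nonneg_of_nonpos hs (hle u hu)

lemma lintegral_rpow_base {g : ℝ → ℝ} (hg : Measurable g)
    (hle : ∀ u ∈ Ioo 0 π, g u ≤ 0) {s : ℝ} (hs : 0 ≤ s) :
    ∫⁻ p, ENNReal.ofReal ((p.1 * exp (g p.2)) ^ s) ∂baseMeasure =
      ENNReal.ofReal (Gamma (1 + s) * ∫ u, exp (s * g u) ∂angleMeasure) := by
  rw [lintegral_baseMeasure (by fun_prop), ENNReal.ofReal_mul (Gamma_pos_of_pos (by linarith)).le,
    ofReal_integral_eq_lintegral_ofReal (integrable_exp_mul_of_nonpos hg hle hs)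
      (ae_of_all _ fun u => (exp_pos _).le), ← lintegral_const_mul _ (by fun_prop)]
  refine lintegral_congr fun u => ?_
  rw [← lintegral_rpow_expMeasure_one hs, ← lintegral_mul_const _ (by fun_prop)]
  refine lintegral_congr_ae ?_
  filter_upwards [ae_expMeasure_one] with l hl
  rw [mul_rpow hl.le (exp_pos _).le, ENNReal.ofReal_mul (rpow_nonneg hl.le _), ← exp_mul,
    mul_comm s]

/-- Negative moments of a positive stable variable. -/
lemma lintegral_rpow_neg_of_isPositiveStable {Ω : Type*} [MeasurableSpace Ω] {P : Measure Ω}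
    [IsProbabilityMeasure P] {α : ℝ} (h0 : 0 < α) {Z : Ω → ℝ} (hZ : IsPositiveStable P α Z)
    {s : ℝ} (hs : 0 < s) :
    ∫⁻ ω, ENNReal.ofReal (Z ω ^ (-s)) ∂P =
      ENNReal.ofReal (Gamma (1 + s / α) / Gamma (1 + s)) := by
  have hΓ := Gamma_pos_of_pos hs
  -- The Gamma integral writes `z ^ (-s)` as a mixture of exponentials `exp (-t * z)`; Tonelli then
  -- brings in the Laplace transform.
  have hpow : ∀ z : ℝ, 0 < z → ENNReal.ofReal (z ^ (-s)) * ENNReal.ofReal (Gamma s) =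
      ∫⁻ t in Ioi 0, ENNReal.ofReal (t ^ (s - 1) * exp (-t * z)) := fun z hz => by
    rw [← ENNReal.ofReal_mul (rpow_nonneg hz.le _)]
    have h1 := integral_rpow_mul_exp_neg_mul_Ioi hs hz
    have h2 : IntegrableOn (fun t : ℝ => t ^ (s - 1) * exp (-t * z)) (Ioi 0) := by
      have := integrableOn_rpow_mul_exp_neg_mul_rpow (p := 1) (s := s - 1) (by linarith) one_pos hz
      refine this.congr_fun (fun t _ => ?_) measurableSet_Ioi
      simp [mul_comm]
    rw [← ofReal_integral_eq_lintegral_ofReal h2]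
    · congr 1
      rw [rpow_neg hz.le, ← inv_rpow hz.le, ← one_div, ← h1]
      refine setIntegral_congr_fun measurableSet_Ioi fun t _ => ?_
      simp [mul_comm]
    · filter_upwards [ae_restrict_mem measurableSet_Ioi] with t ht
      exact mul_nonneg (rpow_nonneg (le_of_lt ht) _) (exp_pos _).le
  have hmeas : AEMeasurable (Function.uncurry fun (ω : Ω) (t : ℝ) =>
      ENNReal.ofReal (t ^ (s - 1) * exp (-t * Z ω))) (P.prod (volume.restrict (Ioi 0))) := by
    have hZ' : AEMeasurable (fun p : Ω × ℝ => Z p.1) (P.prod (volume.restrict (Ioi 0))) :=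
      hZ.aemeasurable.comp_quasiMeasurePreserving Measure.quasiMeasurePreserving_fst
    have h1 : AEMeasurable (fun p : Ω × ℝ => p.2 ^ (s - 1) * exp (-p.2 * Z p.1))
        (P.prod (volume.restrict (Ioi 0))) :=
      (Measurable.aemeasurable (by fun_prop)).mul
        (measurable_exp.comp_aemeasurable ((Measurable.aemeasurable (by fun_prop)).mul hZ'))
    exact h1.ennreal_ofReal
  have hlap : ∀ t : ℝ, 0 < t → ∫⁻ ω, ENNReal.ofReal (t ^ (s - 1) * exp (-t * Z ω)) ∂P =
      ENNReal.ofReal (t ^ (s - 1) * exp (-t ^ α)) := fun t ht => by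
    have hint : Integrable (fun ω => exp (-t * Z ω)) P := by
      refine Integrable.of_bound (measurable_exp.comp_aemeasurable
        (hZ.aemeasurable.const_mul _)).aestronglyMeasurable 1 ?_
      filter_upwards [hZ.pos] with ω hω
      rw [norm_of_nonneg (exp_pos _).le, exp_le_one_iff]
      nlinarith
    rw [← hZ.laplace t ht.le, ← integral_const_mul, ofReal_integral_eq_lintegral_ofReal
      (hint.const_mul _)]
    exact ae_of_all _ fun ω => mul_nonneg (rpow_nonneg ht.le _) (exp_pos _).le
  have key : (∫⁻ ω, ENNReal.ofReal (Z ω ^ (-s)) ∂P) * ENNReal.ofReal (Gamma s) =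
      ENNReal.ofReal (1 / α * Gamma (s / α)) := by
    rw [← lintegral_mul_const' _ _ ENNReal.ofReal_ne_top]
    calc ∫⁻ ω, ENNReal.ofReal (Z ω ^ (-s)) * ENNReal.ofReal (Gamma s) ∂P
        = ∫⁻ ω, (∫⁻ t in Ioi 0, ENNReal.ofReal (t ^ (s - 1) * exp (-t * Z ω))) ∂P := by
          refine lintegral_congr_ae ?_
          filter_upwards [hZ.pos] with ω hω using hpow _ hω
      _ = ∫⁻ t in Ioi 0, ∫⁻ ω, ENNReal.ofReal (t ^ (s - 1) * exp (-t * Z ω)) ∂P :=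
          lintegral_lintegral_swap hmeas
      _ = ∫⁻ t in Ioi 0, ENNReal.ofReal (t ^ (s - 1) * exp (-t ^ α)) :=
          setLIntegral_congr_fun measurableSet_Ioi fun t ht => hlap t ht
      _ = ENNReal.ofReal (1 / α * Gamma (s / α)) := by
          have h1 := integral_rpow_mul_exp_neg_rpow (q := s - 1) h0 (by linarith)
          rw [sub_add_cancel] at h1
          rw [← h1, ofReal_integral_eq_lintegral_ofReal
            (integrableOn_rpow_mul_exp_neg_rpow (by linarith) h0)]
          filter_upwards [ae_restrict_mem measurableSet_Ioi] with t ht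
          exact mul_nonneg (rpow_nonneg (le_of_lt ht) _) (exp_pos _).le
  rw [← ENNReal.mul_left_inj (c := ENNReal.ofReal (Gamma s)) (by simp [hΓ]) ENNReal.ofReal_ne_top,
    key, ← ENNReal.ofReal_mul' hΓ.le]
  congr 1
  rw [add_comm 1, add_comm 1, Gamma_add_one hs.ne', Gamma_add_one (by positivity)]
  field_simp

end

/-! ### Determinacy by moments and Kanter's factorization. -/

noncomputable section

lemma lintegral_exp_eq_tsum {μ : Measure ℝ} (hμ : ∀ᵐ x ∂μ, 0 ≤ x) {t : ℝ} (ht : 0 ≤ t) :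
    ∫⁻ x, ENNReal.ofReal (exp (t * x)) ∂μ =
      ∑' n : ℕ, ENNReal.ofReal (t ^ n / n.factorial) * ∫⁻ x, ENNReal.ofReal (x ^ n) ∂μ := by
  have h : ∀ᵐ x ∂μ, ENNReal.ofReal (exp (t * x)) =
      ∑' n : ℕ, ENNReal.ofReal (t ^ n / n.factorial) * ENNReal.ofReal (x ^ n) := by
    filter_upwards [hμ] with x hx
    have h1 : ∀ n : ℕ, ENNReal.ofReal (t ^ n / n.factorial) * ENNReal.ofReal (x ^ n) =
        ENNReal.ofReal ((t * x) ^ n / n.factorial) := fun n => by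
      rw [← ENNReal.ofReal_mul (by positivity), mul_pow]
      ring_nf
    simp_rw [h1]
    rw [← ENNReal.ofReal_tsum_of_nonneg (fun n => by positivity)
      (Real.summable_pow_div_factorial _), Real.exp_eq_exp_ℝ, NormedSpace.exp_eq_tsum_div]
  rw [lintegral_congr_ae h, lintegral_tsum (fun n => by fun_prop)]
  exact tsum_congr fun n => lintegral_const_mul _ (by fun_prop)

/-- A probability measure on `[0, ∞)` with an exponential moment is determined by its moments. -/
lemma measure_ext_of_moments {μ ν : Measure ℝ} [IsProbabilityMeasure μ] [IsProbabilityMeasure ν]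
    (hμ : ∀ᵐ x ∂μ, 0 ≤ x) (hν : ∀ᵐ x ∂ν, 0 ≤ x)
    (h : ∀ n : ℕ, ∫⁻ x, ENNReal.ofReal (x ^ n) ∂μ = ∫⁻ x, ENNReal.ofReal (x ^ n) ∂ν)
    {t₀ : ℝ} (ht₀ : 0 < t₀) (hfin : ∫⁻ x, ENNReal.ofReal (exp (t₀ * x)) ∂ν < ∞) : μ = ν := by
  have hexp : ∀ t : ℝ, 0 ≤ t → ∫⁻ x, ENNReal.ofReal (exp (t * x)) ∂μ =
      ∫⁻ x, ENNReal.ofReal (exp (t * x)) ∂ν := fun t ht => by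
    rw [lintegral_exp_eq_tsum hμ ht, lintegral_exp_eq_tsum hν ht]
    simp_rw [h]
  have hint : ∀ ρ : Measure ℝ, (∀ᵐ x ∂ρ, 0 ≤ x) → IsProbabilityMeasure ρ →
      ∫⁻ x, ENNReal.ofReal (exp (t₀ * x)) ∂ρ < ∞ →
      ∀ t ≤ t₀, Integrable (fun x : ℝ => exp (t * id x)) ρ := fun ρ hρ _ hfin t ht => by
    have h0 : Integrable (fun x : ℝ => exp (t₀ * x)) ρ :=
      ⟨by fun_prop, by
        rw [hasFiniteIntegral_iff_ofReal (ae_of_all _ fun x => (exp_pos _).le)]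
        exact hfin⟩
    refine h0.mono' (by fun_prop) ?_
    filter_upwards [hρ] with x hx
    rw [norm_of_nonneg (exp_pos _).le, exp_le_exp]
    exact mul_le_mul_of_nonneg_right ht hx
  have hIμ := hint μ hμ inferInstance ((hexp t₀ ht₀.le).trans_lt hfin)
  have hIν := hint ν hν inferInstance hfin
  -- Both transforms are analytic on a half-plane containing the imaginary axis, so agreement for
  -- small positive `t` forces equality of characteristic functions.
  have hsub : ∀ ρ : Measure ℝ, (∀ t ≤ t₀, Integrable (fun x : ℝ => exp (t * id x)) ρ) →
      AnalyticOnNhd ℂ (complexMGF id ρ) {z | z.re < t₀} := fun ρ hρ z hz => by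
    refine analyticOnNhd_complexMGF z ?_
    exact interior_mono (show Iio t₀ ⊆ integrableExpSet id ρ from fun t ht => hρ t (le_of_lt ht))
      (by rw [interior_Iio]; exact hz)
  have hmgf : ∀ t : ℝ, 0 ≤ t → t ≤ t₀ → mgf id μ t = mgf id ν t := fun t ht ht' => by
    simp only [mgf]
    rw [integral_eq_lintegral_of_nonneg_ae (ae_of_all _ fun x => (exp_pos _).le)
      (hIμ t ht').aestronglyMeasurable,
      integral_eq_lintegral_of_nonneg_ae (ae_of_all _ fun x => (exp_pos _).le)
      (hIν t ht').aestronglyMeasurable]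
    exact congrArg _ (hexp t ht)
  have hpre : IsPreconnected {z : ℂ | z.re < t₀} :=
    (convex_halfSpace_re_lt t₀).isPreconnected
  have hEq : EqOn (complexMGF id μ) (complexMGF id ν) {z | z.re < t₀} := by
    refine AnalyticOnNhd.eqOn_of_preconnected_of_frequently_eq (hsub μ hIμ) (hsub ν hIν) hpre
      (z₀ := ((t₀ / 2 : ℝ) : ℂ)) (by simp only [mem_ofPred_eq, Complex.ofReal_re]; linarith) ?_
    have hT : Tendsto (fun x : ℝ => (x : ℂ)) (𝓝[≠] (t₀ / 2)) (𝓝[≠] ((t₀ / 2 : ℝ) : ℂ)) := by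
      refine tendsto_nhdsWithin_iff.2 ⟨?_, ?_⟩
      · exact (Complex.continuous_ofReal.tendsto _).mono_left nhdsWithin_le_nhds
      · filter_upwards [self_mem_nhdsWithin] with x hx
        exact fun h => hx (Complex.ofReal_injective h)
    refine hT.frequently (Eventually.frequently ?_)
    filter_upwards [nhdsWithin_le_nhds (Ioo_mem_nhds (half_pos ht₀) (half_lt_self ht₀))] with x hx
    rw [complexMGF_ofReal, complexMGF_ofReal, hmgf x hx.1.le hx.2.le]
  refine Measure.ext_of_charFun (funext fun t => ?_)
  rw [← complexMGF_id_mul_I, ← complexMGF_id_mul_I]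
  exact hEq (by simpa using ht₀)

/-- Kanter's factorization, in a normalized form: the variable
`(1 - α) α ^ (α / (1 - α)) Z ^ (-α / (1 - α))` is distributed as the product of an exponential
variable and `exp (logKanter α U)`. -/
lemma map_stable_eq {Ω : Type*} [MeasurableSpace Ω] {P : Measure Ω}
    [IsProbabilityMeasure P] {α : ℝ} (h0 : 0 < α) (h1 : α < 1) {Z : Ω → ℝ}
    (hZ : IsPositiveStable P α Z) :
    P.map (fun ω => (1 - α) * α ^ (α / (1 - α)) * Z ω ^ (-α / (1 - α))) =
      baseMeasure.map (fun p => p.1 * exp (logKanter α p.2)) := by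
  have h1a : 0 < 1 - α := by linarith
  have hg := measurable_logKanter α
  have hgle : ∀ u ∈ Ioo 0 π, logKanter α u ≤ 0 := fun u hu => logKanter_nonpos h0.le h1 hu
  set H := α * log α + (1 - α) * log (1 - α) with hH
  set V : ℝ × ℝ → ℝ := fun p => p.1 * exp (logKanter α p.2) with hV
  have hVm : Measurable V := by fun_prop
  have hVpos : ∀ᵐ p ∂baseMeasure, 0 < V p := by
    filter_upwards [ae_baseMeasure] with p hp using mul_pos hp.1 (exp_pos _)
  have hm1 : AEMeasurable (fun ω => exp H * Z ω ^ (-α)) P := by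
    have := hZ.aemeasurable
    fun_prop
  have hm2 : AEMeasurable (fun p => V p ^ (1 - α)) baseMeasure := by fun_prop
  have hp1 := Measure.isProbabilityMeasure_map hm1
  have hp2 := Measure.isProbabilityMeasure_map hm2
  have hmeas0 : MeasurableSet {x : ℝ | 0 ≤ x} := measurableSet_Ici
  -- Moments are compared after raising to the power `1 - α`: the path integral evaluates exactly
  -- the powers `n * (1 - α)` of `exp (logKanter α u)` for integer `n`.
  have key : P.map (fun ω => exp H * Z ω ^ (-α)) =
      baseMeasure.map (fun p => V p ^ (1 - α)) := by
    refine measure_ext_of_moments ((ae_map_iff hm1 hmeas0).2 ?_) ((ae_map_iff hm2 hmeas0).2 ?_)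
      (fun n => ?_) one_half_pos ?_
    · filter_upwards [hZ.pos] with ω hω using mul_nonneg (exp_pos _).le (rpow_nonneg hω.le _)
    · filter_upwards [hVpos] with p hp using rpow_nonneg hp.le _
    · rw [lintegral_map' (by fun_prop) hm1, lintegral_map' (by fun_prop) hm2]
      rcases Nat.eq_zero_or_pos n with rfl | hn
      · simp
      have hn' : (0 : ℝ) < n := by exact_mod_cast hn
      have hL : ∫⁻ ω, ENNReal.ofReal ((exp H * Z ω ^ (-α)) ^ n) ∂P =
          ENNReal.ofReal (exp (n * H)) *
            ENNReal.ofReal (Gamma (1 + n) / Gamma (1 + α * n)) := by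
        have := lintegral_rpow_neg_of_isPositiveStable h0 hZ (mul_pos h0 hn')
        rw [mul_div_cancel_left₀ _ h0.ne'] at this
        rw [← this, ← lintegral_const_mul' _ _ ENNReal.ofReal_ne_top]
        refine lintegral_congr_ae ?_
        filter_upwards [hZ.pos] with ω hω
        rw [mul_pow, ← exp_nat_mul, ENNReal.ofReal_mul (exp_pos _).le, ← rpow_natCast,
          ← rpow_mul hω.le, neg_mul]
      have hR : ∫⁻ p, ENNReal.ofReal ((V p ^ (1 - α)) ^ n) ∂baseMeasure =
          ENNReal.ofReal (Gamma (1 + n * (1 - α)) * (exp (n * H) * realChoose n (α * n))) := by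
        rw [hH, ← integral_exp_logKanter h0 h1 n, ← lintegral_rpow_base hg hgle (by positivity)]
        refine lintegral_congr_ae ?_
        filter_upwards [hVpos] with p hp
        rw [← rpow_natCast, ← rpow_mul hp.le, mul_comm (1 - α)]
      rw [hL, hR, ← ENNReal.ofReal_mul (exp_pos _).le, realChoose]
      congr 1
      have e1 : 1 + (n : ℝ) - α * n = 1 + n * (1 - α) := by ring
      have hΓ := (Gamma_pos_of_pos (show 0 < 1 + n * (1 - α) by positivity)).ne'
      rw [e1, add_comm 1 (n : ℝ), Gamma_nat_eq_factorial]
      field_simp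
    · rw [lintegral_map' (by fun_prop) hm2]
      -- Since `V ^ (1 - α) ≤ 1 + V` and `V` is at most the exponential variable, an exponential
      -- moment of order `1 / 2` exists.
      have hb : ∀ᵐ p ∂baseMeasure, ENNReal.ofReal (exp (1 / 2 * V p ^ (1 - α))) ≤
          ENNReal.ofReal (exp (1 / 2)) * ENNReal.ofReal (exp (p.1 / 2)) := by
        filter_upwards [ae_baseMeasure, hVpos] with p hp hVp
        rw [← ENNReal.ofReal_mul (exp_pos _).le, ← exp_add]
        refine ENNReal.ofReal_le_ofReal (exp_le_exp.2 ?_)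
        have h2 : V p ≤ p.1 :=
          mul_le_of_le_one_right hp.1.le (exp_le_one_iff.2 (hgle _ hp.2))
        have h3 : V p ^ (1 - α) ≤ 1 + V p := by
          rcases le_total (V p) 1 with h | h
          · exact (rpow_le_one hVp.le h h1a.le).trans (by linarith)
          · calc V p ^ (1 - α) ≤ V p ^ (1 : ℝ) := rpow_le_rpow_of_exponent_le h (by linarith)
              _ ≤ 1 + V p := by rw [rpow_one]; linarith
        linarith
      refine (lintegral_mono_ae hb).trans_lt ?_
      rw [lintegral_const_mul' _ _ ENNReal.ofReal_ne_top]
      refine ENNReal.mul_lt_top ENNReal.ofReal_lt_top ?_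
      rw [lintegral_baseMeasure (by fun_prop)]
      simpa using! lintegral_exp_half_expMeasure_one
  -- Undo the power; `exp (H / (1 - α))` is the constant `(1 - α) * α ^ (α / (1 - α))`.
  have hpow : Measurable fun x : ℝ => x ^ (1 - α)⁻¹ := by fun_prop
  have key2 := congrArg (Measure.map fun x : ℝ => x ^ (1 - α)⁻¹) key
  rw [AEMeasurable.map_map_of_aemeasurable hpow.aemeasurable hm1,
    AEMeasurable.map_map_of_aemeasurable hpow.aemeasurable hm2] at key2
  rw [Measure.map_congr (g := (fun x : ℝ => x ^ (1 - α)⁻¹) ∘ fun ω => exp H * Z ω ^ (-α)), key2]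
  · refine Measure.map_congr ?_
    filter_upwards [hVpos] with p hp
    rw [Function.comp_apply, rpow_rpow_inv hp.le h1a.ne']
  · filter_upwards [hZ.pos] with ω hω
    rw [Function.comp_apply, mul_rpow (exp_pos _).le (rpow_nonneg hω.le _), ← rpow_mul hω.le,
      ← exp_mul, div_eq_mul_inv (-α)]
    congr 1
    rw [rpow_def_of_pos h0]
    nth_rewrite 1 [← exp_log h1a]
    rw [← exp_add, hH]
    congr 1
    field_simp
    ring

end

/-! ### The limit `a → 1` and the 1-stable law. -/

noncomputable section

lemma Gamma_add_nat_eq_prod {x : ℝ} (hx : 0 < x) (n : ℕ) :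
    Gamma (x + n) = Gamma x * ∏ j ∈ Finset.range n, (x + j) := by
  induction n with
  | zero => simp
  | succ n ih =>
    have h : x + ((n + 1 : ℕ) : ℝ) = (x + n) + 1 := by push_cast; ring
    rw [h, Gamma_add_one (by positivity), ih, Finset.prod_range_succ]
    ring

lemma tendsto_factorial_div_Gamma {s : ℝ} (hs1 : s < 1) :
    Tendsto (fun N : ℕ => (N : ℝ) ^ (-s) * (N.factorial / Gamma (1 + N - s))) atTop (𝓝 1) := by
  have hx : 0 < 1 - s := by linarith
  have hΓ := Gamma_pos_of_pos hx
  have h1 := ((GammaSeq_tendsto_Gamma (1 - s)).div_const (Gamma (1 - s)))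
  rw [div_self hΓ.ne'] at h1
  -- Euler's product in `GammaSeq` has one factor more than `Gamma (1 - s + N) / Gamma (1 - s)`;
  -- this corrects for it.
  have h2 : Tendsto (fun N : ℕ => 1 + (1 - s) / (N : ℝ)) atTop (𝓝 (1 + 0)) :=
    tendsto_const_nhds.add (tendsto_const_div_atTop_nhds_zero_nat _)
  have h3 := h1.mul h2
  rw [add_zero, mul_one] at h3
  refine h3.congr' ?_
  filter_upwards [eventually_gt_atTop 0] with N hN
  have hN' : (0 : ℝ) < N := by exact_mod_cast hN
  have e1 : 1 + (N : ℝ) - s = (1 - s) + N := by ring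
  have h4 := Gamma_add_nat_eq_prod hx N
  have hp : 0 < ∏ j ∈ Finset.range N, (1 - s + (j : ℝ)) :=
    Finset.prod_pos fun j _ => by positivity
  have e2 : (N : ℝ) ^ (1 - s) = N * (N : ℝ) ^ (-s) := by
    rw [sub_eq_add_neg, rpow_add hN', rpow_one]
  have hq : (1 - s) + (N : ℝ) ≠ 0 := by positivity
  rw [GammaSeq, Finset.prod_range_succ, e1, h4, e2]
  field_simp
  ring

/-- Taking `a = 1 - s / N` and `n = N` in `integral_exp_logKanter` keeps the exponent `n * (1 - a)`
equal to `s`; the left side converges by domination and the right side by Gamma asymptotics. -/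
lemma integral_exp_mul_logKanterOne {s : ℝ} (hs0 : 0 < s) (hs1 : s < 1) :
    ∫ u, exp (s * logKanterOne u) ∂angleMeasure = exp (s * log s - s) / Gamma (1 + s) := by
  have hT : Tendsto (fun N : ℕ => 1 - s / (N : ℝ)) atTop (𝓝[<] 1) := by
    refine tendsto_nhdsWithin_iff.2 ⟨?_, ?_⟩
    · simpa using (tendsto_const_div_atTop_nhds_zero_nat s).const_sub 1
    · filter_upwards [eventually_gt_atTop 0] with N hN
      have : 0 < s / (N : ℝ) := by positivity
      simp only [mem_Iio]
      linarith
  have hmem : ∀ᶠ N : ℕ in atTop, 0 < 1 - s / (N : ℝ) ∧ 1 - s / (N : ℝ) < 1 := by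
    filter_upwards [eventually_gt_atTop 0] with N hN
    have hN' : (1 : ℝ) ≤ N := by exact_mod_cast hN
    have h1 : 0 < s / (N : ℝ) := by positivity
    have h2 : s / (N : ℝ) < 1 := by rw [div_lt_one (by linarith)]; linarith
    constructor <;> linarith
  have hlim1 : Tendsto (fun N : ℕ => ∫ u, exp (s * logKanter (1 - s / (N : ℝ)) u) ∂angleMeasure)
      atTop (𝓝 (∫ u, exp (s * logKanterOne u) ∂angleMeasure)) := by
    refine tendsto_integral_filter_of_dominated_convergence (fun _ => 1) ?_ ?_
      (integrable_const _) ?_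
    · exact Eventually.of_forall fun N =>
        (measurable_exp.comp ((measurable_logKanter _).const_mul _)).aestronglyMeasurable
    · filter_upwards [hmem] with N hN
      filter_upwards [ae_angleMeasure] with u hu
      rw [norm_of_nonneg (exp_pos _).le, exp_le_one_iff]
      exact mul_nonpos_of_nonneg_of_nonpos hs0.le (logKanter_nonpos hN.1.le hN.2 hu)
    · filter_upwards [ae_angleMeasure] with u hu
      exact (continuous_exp.tendsto _).comp
        (((tendsto_logKanter hu).comp hT).const_mul s)
  refine tendsto_nhds_unique hlim1 ?_
  have h1 : Tendsto (fun N : ℕ => (N : ℝ) * log (1 - s / N)) atTop (𝓝 (-s)) := by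
    have := (tendsto_mul_log_one_add_div_atTop (-s)).comp tendsto_natCast_atTop_atTop
    refine this.congr fun N => ?_
    simp [neg_div, sub_eq_add_neg]
  have h2 := (h1.mul (hT.mono_right nhdsWithin_le_nhds))
  rw [mul_one] at h2
  have h3 := (((continuous_exp.tendsto _).comp h2).mul (tendsto_factorial_div_Gamma hs1)).const_mul
    (exp (s * log s) / Gamma (1 + s))
  have e : exp (s * log s) / Gamma (1 + s) * (exp (-s) * 1) =
      exp (s * log s - s) / Gamma (1 + s) := by
    rw [sub_eq_add_neg, exp_add]; ring
  rw [e] at h3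
  refine h3.congr' ?_
  filter_upwards [hmem, eventually_gt_atTop 0] with N hN hpos
  have hN' : (0 : ℝ) < N := by exact_mod_cast hpos
  have e1 : (N : ℝ) * (1 - (1 - s / N)) = s := by field_simp; ring
  have e2 : (1 - s / N) * (N : ℝ) = N - s := by field_simp
  have key := integral_exp_logKanter hN.1 hN.2 N
  rw [e1] at key
  rw [key, realChoose, e2]
  have e3 : exp (N * ((1 - s / N) * log (1 - s / N) + (1 - (1 - s / N)) *
      log (1 - (1 - s / N)))) =
      exp (N * log (1 - s / N) * (1 - s / N)) * (exp (s * log s) * (N : ℝ) ^ (-s)) := by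
    rw [rpow_def_of_pos hN', ← exp_add, ← exp_add, sub_sub_cancel, log_div hs0.ne' hN'.ne']
    congr 1
    field_simp
    ring
  have e4 : 1 + ((N : ℝ) - s) = 1 + N - s := by ring
  have e5 : 1 + (N : ℝ) - (N - s) = 1 + s := by ring
  rw [e3, e4, e5, Function.comp_apply]
  ring

/-- The logarithm of the product of an exponential variable and `exp (logKanterOne U)`. -/
def logLimit (p : ℝ × ℝ) : ℝ := log (p.1 * exp (logKanterOne p.2))

lemma measurable_logLimit : Measurable logLimit := by
  have := measurable_logKanterOne
  unfold logLimit
  fun_prop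

lemma exp_mul_logLimit (s : ℝ) : ∀ᵐ p ∂baseMeasure,
    exp (s * logLimit p) = (p.1 * exp (logKanterOne p.2)) ^ s := by
  filter_upwards [ae_baseMeasure] with p hp
  rw [rpow_def_of_pos (mul_pos hp.1 (exp_pos _)), mul_comm, logLimit]

lemma integrable_exp_mul_logLimit {s : ℝ} (hs : 0 ≤ s) :
    Integrable (fun p => exp (s * logLimit p)) baseMeasure := by
  have := measurable_logLimit
  refine ⟨by fun_prop, ?_⟩
  rw [hasFiniteIntegral_iff_ofReal (ae_of_all _ fun x => (exp_pos _).le),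
    lintegral_congr_ae ((exp_mul_logLimit s).mono fun p hp => by rw [hp]),
    lintegral_rpow_base measurable_logKanterOne (fun u hu => logKanterOne_nonpos hu) hs]
  exact ENNReal.ofReal_lt_top

lemma mgf_logLimit {s : ℝ} (hs0 : 0 < s) (hs1 : s < 1) :
    mgf logLimit baseMeasure s = exp (s * log s - s) := by
  have hΓ := Gamma_pos_of_pos (show 0 < 1 + s by linarith)
  rw [mgf, integral_eq_lintegral_of_nonneg_ae (ae_of_all _ fun x => (exp_pos _).le)
    (integrable_exp_mul_logLimit hs0.le).aestronglyMeasurable,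
    lintegral_congr_ae ((exp_mul_logLimit s).mono fun p hp => by rw [hp]),
    lintegral_rpow_base measurable_logKanterOne (fun u hu => logKanterOne_nonpos hu) hs0.le,
    integral_exp_mul_logKanterOne hs0 hs1, mul_div_cancel₀ _ hΓ.ne',
    ENNReal.toReal_ofReal (exp_pos _).le]

/-- Identity theorem on the right half-plane, starting from the real interval `(0, 1)`. -/
lemma complexMGF_logLimit {z : ℂ} (hz : 0 < z.re) :
    complexMGF logLimit baseMeasure z = Complex.exp (z * Complex.log z - z) := by
  have hA : AnalyticOnNhd ℂ (complexMGF logLimit baseMeasure) {z | 0 < z.re} := fun w hw => by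
    refine analyticOnNhd_complexMGF w ?_
    exact interior_mono (show Ioi 0 ⊆ integrableExpSet logLimit baseMeasure from
      fun t ht => integrable_exp_mul_logLimit (le_of_lt ht)) (by rw [interior_Ioi]; exact hw)
  have hB : AnalyticOnNhd ℂ (fun z => Complex.exp (z * Complex.log z - z)) {z | 0 < z.re} :=
    fun w hw => ((analyticAt_id.mul (analyticAt_clog (Or.inl hw))).sub analyticAt_id).cexp
  refine AnalyticOnNhd.eqOn_of_preconnected_of_frequently_eq hA hB
    (convex_halfSpace_re_gt 0).isPreconnected (z₀ := ((1 / 2 : ℝ) : ℂ))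
    (by simp only [mem_ofPred_eq, Complex.ofReal_re]; norm_num) ?_ hz
  have hT : Tendsto (fun x : ℝ => (x : ℂ)) (𝓝[≠] (1 / 2)) (𝓝[≠] ((1 / 2 : ℝ) : ℂ)) := by
    refine tendsto_nhdsWithin_iff.2 ⟨?_, ?_⟩
    · exact (Complex.continuous_ofReal.tendsto _).mono_left nhdsWithin_le_nhds
    · filter_upwards [self_mem_nhdsWithin] with x hx
      exact fun h => hx (Complex.ofReal_injective h)
  refine hT.frequently (Eventually.frequently ?_)
  filter_upwards [nhdsWithin_le_nhds (Ioo_mem_nhds one_half_pos one_half_lt_one)] with x hx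
  rw [complexMGF_ofReal, mgf_logLimit hx.1 hx.2]
  push_cast
  rw [Complex.ofReal_log hx.1.le]

/-- The imaginary axis is only the boundary of the domain of analyticity used above, so it is
reached as `ε → 0+`, with dominating function `1 + exp (logLimit p)`. -/
lemma complexMGF_logLimit_mul_I {t : ℝ} (ht : t ≠ 0) :
    complexMGF logLimit baseMeasure (t * Complex.I) =
      Complex.exp (t * Complex.I * Complex.log (t * Complex.I) - t * Complex.I) := by
  have hc : Tendsto (fun ε : ℝ => (ε : ℂ) + t * Complex.I) (𝓝[>] 0) (𝓝 (t * Complex.I)) := by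
    have : Continuous fun ε : ℝ => (ε : ℂ) + t * Complex.I := by fun_prop
    have h := this.tendsto 0
    simp only [Complex.ofReal_zero, zero_add] at h
    exact h.mono_left nhdsWithin_le_nhds
  have hslit : (t * Complex.I : ℂ) ∈ Complex.slitPlane := Or.inr (by simpa using ht)
  have hR : ContinuousAt (fun z => Complex.exp (z * Complex.log z - z)) (t * Complex.I : ℂ) :=
    ((continuousAt_id.mul (continuousAt_clog hslit)).sub continuousAt_id).cexp
  have hlim : Tendsto (fun ε : ℝ => complexMGF logLimit baseMeasure (ε + t * Complex.I)) (𝓝[>] 0)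
      (𝓝 (complexMGF logLimit baseMeasure (t * Complex.I))) := by
    have hm := measurable_logLimit
    refine tendsto_integral_filter_of_dominated_convergence (fun p => 1 + exp (1 * logLimit p))
      ?_ ?_ ((integrable_const _).add (integrable_exp_mul_logLimit zero_le_one)) ?_
    · exact Eventually.of_forall fun ε => by fun_prop
    · filter_upwards [Ioo_mem_nhdsGT one_pos] with ε hε
      refine ae_of_all _ fun p => ?_
      rw [Complex.norm_exp]
      have : (((ε : ℂ) + t * Complex.I) * (logLimit p : ℂ)).re = ε * logLimit p := by simp
      rw [this]
      rcases le_total (logLimit p) 0 with h | h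
      · have : exp (ε * logLimit p) ≤ 1 :=
          exp_le_one_iff.2 (mul_nonpos_of_nonneg_of_nonpos hε.1.le h)
        linarith [exp_pos (1 * logLimit p)]
      · have : exp (ε * logLimit p) ≤ exp (1 * logLimit p) :=
          exp_le_exp.2 (mul_le_mul_of_nonneg_right hε.2.le h)
        linarith
    · exact ae_of_all _ fun p => (Complex.continuous_exp.tendsto _).comp (hc.mul_const _)
  refine tendsto_nhds_unique hlim ((hR.tendsto.comp hc).congr' ?_)
  filter_upwards [self_mem_nhdsWithin] with ε hε
  have hε' : 0 < ((ε : ℂ) + t * Complex.I).re := by simpa using! hε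
  rw [complexMGF_logLimit hε', Function.comp_apply]

lemma mul_I_mul_log {t : ℝ} (ht : t ≠ 0) :
    t * Complex.I * Complex.log (t * Complex.I) - t * Complex.I =
      Complex.I * t * ((log |t| - 1 : ℝ) : ℂ) - ((π * |t| / 2 : ℝ) : ℂ) := by
  have hI := Complex.I_mul_I
  rcases lt_or_gt_of_ne ht with h | h
  · have e : (t * Complex.I : ℂ) = ((-t : ℝ) : ℂ) * (-Complex.I) := by push_cast; ring
    have hl : Complex.log (t * Complex.I) = log (-t) + -(π / 2) * Complex.I := by
      rw [e, Complex.log_ofReal_mul (by linarith) (by simp), Complex.log_neg_I]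
    rw [hl, abs_of_neg h]
    push_cast
    linear_combination (-(t : ℂ) * (π / 2)) * hI
  · have hl : Complex.log (t * Complex.I) = log t + π / 2 * Complex.I := by
      rw [Complex.log_ofReal_mul h (by simp), Complex.log_I]
    rw [hl, abs_of_pos h]
    push_cast
    linear_combination ((t : ℂ) * (π / 2)) * hI

/-- The exponential of the spectrally negative `1`-stable variable is distributed as the product
of an exponential variable and `exp (logKanterOne U)`. -/
lemma map_logStable_eq {Ω : Type*} [MeasurableSpace Ω] {P : Measure Ω}
    [IsProbabilityMeasure P] {S : Ω → ℝ} (hS : IsLogStable P S) :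
    AEMeasurable S P ∧ P.map S = baseMeasure.map (fun p => p.1 * exp (logKanterOne p.2)) := by
  have hm := measurable_logLimit
  have hX := hS.log_stable.aemeasurable
  have hp1 := Measure.isProbabilityMeasure_map hX
  have hp2 := Measure.isProbabilityMeasure_map (μ := baseMeasure) hm.aemeasurable
  have key : P.map (fun ω => log (S ω)) = baseMeasure.map logLimit := by
    refine Measure.ext_of_charFun (funext fun t => ?_)
    rw [← complexMGF_mul_I hX, ← complexMGF_mul_I hm.aemeasurable]
    rcases eq_or_ne t 0 with rfl | ht
    · simp [complexMGF]
    rw [complexMGF_logLimit_mul_I ht, mul_I_mul_log ht, ← hS.log_stable.charFun_eq t, complexMGF]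
    simp_rw [mul_comm Complex.I]
  have hexp : S =ᵐ[P] fun ω => exp (log (S ω)) := by
    filter_upwards [hS.pos] with ω hω using (exp_log hω).symm
  refine ⟨(measurable_exp.comp_aemeasurable hX).congr hexp.symm, ?_⟩
  have key2 := congrArg (Measure.map exp) key
  rw [AEMeasurable.map_map_of_aemeasurable measurable_exp.aemeasurable hX,
    AEMeasurable.map_map_of_aemeasurable measurable_exp.aemeasurable hm.aemeasurable] at key2
  rw [Measure.map_congr hexp]
  refine key2.trans (Measure.map_congr ?_)
  filter_upwards [ae_baseMeasure] with p hp
  exact exp_log (mul_pos hp.1 (exp_pos _))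

end

/-! ### Exponential mixtures. -/

noncomputable section

/-- `X` is distributed as the product of a unit exponential variable and `exp (g U)`, where `U` is
independent and uniform on `(0, π)`. -/
structure IsExpMixture {Ω : Type*} [MeasurableSpace Ω] (P : Measure Ω) (X : Ω → ℝ)
    (g : ℝ → ℝ) : Prop where
  aemeasurable : AEMeasurable X P
  measurable : Measurable g
  map_eq : P.map X = baseMeasure.map (fun p => p.1 * exp (g p.2))

variable {Ω Ω' : Type*} [MeasurableSpace Ω] [MeasurableSpace Ω'] {P : Measure Ω} {Q : Measure Ω'}
  {X : Ω → ℝ} {Y : Ω' → ℝ} {g h : ℝ → ℝ}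

lemma IsExpMixture.measurable_mul (hX : IsExpMixture P X g) :
    Measurable fun p : ℝ × ℝ => p.1 * exp (g p.2) := by
  have := hX.measurable
  fun_prop

lemma IsExpMixture.lintegral_comp (hX : IsExpMixture P X g) {f : ℝ → ℝ≥0∞} (hf : Measurable f) :
    ∫⁻ ω, f (X ω) ∂P = ∫⁻ p, f (p.1 * exp (g p.2)) ∂baseMeasure := by
  rw [← lintegral_map' hf.aemeasurable hX.aemeasurable, hX.map_eq,
    lintegral_map hf hX.measurable_mul]

lemma IsExpMixture.extExpectation_comp (hX : IsExpMixture P X g) {φ : ℝ → ℝ} (hφ : Measurable φ) :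
    extExpectation P (fun ω => φ (X ω)) =
      extExpectation baseMeasure (fun p => φ (p.1 * exp (g p.2))) := by
  rw [extExpectation, extExpectation, hX.lintegral_comp (f := fun x => ENNReal.ofReal (φ x))
    (by fun_prop), hX.lintegral_comp (f := fun x => ENNReal.ofReal (-φ x)) (by fun_prop)]

lemma IsExpMixture.const_mul (hX : IsExpMixture P X g) (c : ℝ) :
    IsExpMixture P (fun ω => exp c * X ω) (fun u => c + g u) := by
  have hm := hX.measurable
  refine ⟨hX.aemeasurable.const_mul _, by fun_prop, ?_⟩
  have h1 := congrArg (Measure.map fun x : ℝ => exp c * x) hX.map_eq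
  have hmul : Measurable fun x : ℝ => exp c * x := by fun_prop
  rw [AEMeasurable.map_map_of_aemeasurable hmul.aemeasurable hX.aemeasurable,
    AEMeasurable.map_map_of_aemeasurable hmul.aemeasurable hX.measurable_mul.aemeasurable] at h1
  refine h1.trans (congrArg (fun f => Measure.map f baseMeasure) (funext fun p => ?_))
  rw [Function.comp_apply, exp_add]
  ring

lemma isExpMixture_stable [IsProbabilityMeasure P] {α : ℝ} (h0 : 0 < α) (h1 : α < 1)
    (hX : IsPositiveStable P α X) :
    IsExpMixture P (fun ω => (1 - α) * α ^ (α / (1 - α)) * X ω ^ (-α / (1 - α)))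
      (logKanter α) where
  aemeasurable := by
    have := hX.aemeasurable
    fun_prop
  measurable := measurable_logKanter α
  map_eq := map_stable_eq h0 h1 hX

lemma isExpMixture_logStable [IsProbabilityMeasure P] (hX : IsLogStable P X) :
    IsExpMixture P X logKanterOne :=
  ⟨(map_logStable_eq hX).1, measurable_logKanterOne, (map_logStable_eq hX).2⟩

lemma isExpMixture_exp (hX : HasLaw X (expMeasure 1) P) :
    IsExpMixture P X (fun _ => 0) where
  aemeasurable := hX.aemeasurable
  measurable := measurable_const
  map_eq := by
    have : (fun p : ℝ × ℝ => p.1 * exp 0) = Prod.fst := by ext p; simp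
    rw [hX.map_eq, this, baseMeasure, Measure.map_fst_prod, measure_univ, one_smul]

/-! ### Stochastic order by coupling, and optimality from the tails. -/

section Stochastic

/-- Coupling: both mixtures are realized with the same exponential variable and the same angle. -/
lemma stochasticLE_of_le (hX : IsExpMixture P X g) (hY : IsExpMixture Q Y h)
    (hgh : ∀ u ∈ Ioo 0 π, g u ≤ h u) : StochasticLE P Q X Y := by
  intro φ hφ _ _
  rw [hX.extExpectation_comp hφ.measurable, hY.extExpectation_comp hφ.measurable]
  have hle : ∀ᵐ p ∂baseMeasure, φ (p.1 * exp (g p.2)) ≤ φ (p.1 * exp (h p.2)) := by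
    filter_upwards [ae_baseMeasure] with p hp
    exact hφ (mul_le_mul_of_nonneg_left (exp_le_exp.2 (hgh _ hp.2)) hp.1.le)
  refine EReal.sub_le_sub ?_ ?_
  · exact EReal.coe_ennreal_le_coe_ennreal_iff.2
      (lintegral_mono_ae (hle.mono fun p hp => ENNReal.ofReal_le_ofReal hp))
  · exact EReal.coe_ennreal_le_coe_ennreal_iff.2
      (lintegral_mono_ae (hle.mono fun p hp => ENNReal.ofReal_le_ofReal (neg_le_neg hp)))

lemma lintegral_indicator_Ioi (hX : AEMeasurable X P) (x : ℝ) :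
    ∫⁻ ω, ENNReal.ofReal ((Ioi x).indicator 1 (X ω)) ∂P = P {ω | x < X ω} := by
  have : ∀ ω, ENNReal.ofReal ((Ioi x).indicator 1 (X ω)) = (X ⁻¹' Ioi x).indicator 1 ω :=
    fun ω => by by_cases h : x < X ω <;> simp [h]
  simp_rw [this]
  exact lintegral_indicator_one₀ (hX.nullMeasurableSet_preimage measurableSet_Ioi)

/-- The tail probabilities of stochastically ordered variables are ordered. -/
lemma measure_lt_le_of_stochasticLE
    (hX : AEMeasurable X P) (hY : AEMeasurable Y Q) (hle : StochasticLE P Q X Y) (x : ℝ) :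
    P {ω | x < X ω} ≤ Q {ω | x < Y ω} := by
  set φ : ℝ → ℝ := (Ioi x).indicator 1 with hφ
  have hneg : ∀ y, ENNReal.ofReal (-φ y) = 0 := fun y => by
    rw [ENNReal.ofReal_eq_zero, neg_nonpos]
    exact indicator_nonneg (fun _ _ => zero_le_one) y
  have hmono : Monotone φ := fun y z hyz => by
    by_cases h : x < y
    · simp [hφ, h, h.trans_le hyz]
    · rw [hφ, indicator_of_notMem (by simpa using h)]
      exact indicator_nonneg (fun _ _ => zero_le_one) z
  have := hle φ hmono (Or.inr (by simp [hneg])) (Or.inr (by simp [hneg]))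
  simp only [extExpectation, hneg, lintegral_zero, EReal.coe_ennreal_zero, sub_zero,
    EReal.coe_ennreal_le_coe_ennreal_iff] at this
  rwa [hφ, lintegral_indicator_Ioi hX, lintegral_indicator_Ioi hY] at this

lemma angleMeasure_Ioo_pos {δ : ℝ} (h0 : 0 < δ) : 0 < angleMeasure (Ioo 0 δ) := by
  rw [angleMeasure, Measure.smul_apply, Measure.restrict_apply measurableSet_Ioo, Ioo_inter_Ioo,
    smul_eq_mul, ENNReal.mul_pos_iff]
  refine ⟨ENNReal.inv_pos.2 ENNReal.ofReal_ne_top, ?_⟩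
  simp [h0, pi_pos]

/-- Ordered exponential mixtures whose mixing functions lie between the `1`-stable one and `0` are
ordered in an optimal way. -/
lemma optimalStochasticLE_of_le [IsProbabilityMeasure P] [IsProbabilityMeasure Q]
    (hX : IsExpMixture P X g) (hY : IsExpMixture Q Y h)
    (hgh : ∀ u ∈ Ioo 0 π, g u ≤ h u) (hg : ∀ u ∈ Ioo 0 π, logKanterOne u ≤ g u)
    (hh : ∀ u ∈ Ioo 0 π, h u ≤ 0) : OptimalStochasticLE P Q X Y := by
  refine ⟨stochasticLE_of_le hX hY hgh, ?_⟩
  rintro ⟨c, hc, hle⟩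
  -- Split the excess in two: near `u = 0` the mixing function costs at most `d`, so a net factor
  -- `exp d` remains.
  obtain ⟨d, rfl⟩ : ∃ d, c = exp (d + d) := ⟨log c / 2, by rw [add_halves, exp_log (by linarith)]⟩
  have hd : 0 < d := by
    have := one_lt_exp_iff.1 hc
    linarith
  have hcX := hX.const_mul (d + d)
  have htail := measure_lt_le_of_stochasticLE hcX.aemeasurable hY.aemeasurable hle
  obtain ⟨δ, hδ0, hδ⟩ : ∃ δ, 0 < δ ∧ ∀ u ∈ Ioo 0 δ, u ∈ Ioo 0 π ∧ -d < logKanterOne u := by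
    have h1 : ∀ᶠ u in 𝓝[>] (0 : ℝ), u ∈ Ioo 0 π ∧ -d < logKanterOne u :=
      Filter.Eventually.and (Ioo_mem_nhdsGT pi_pos)
        (tendsto_logKanterOne_zero (Ioi_mem_nhds (by linarith)))
    obtain ⟨δ, hδ0, hδ⟩ := mem_nhdsGT_iff_exists_Ioo_subset.1 h1
    exact ⟨δ, hδ0, fun u hu => hδ hu⟩
  have hup : ∀ x : ℝ, 0 ≤ x → Q {ω | x < Y ω} ≤ ENNReal.ofReal (exp (-x)) := fun x hx => by
    have h1 : Q {ω | x < Y ω} = Q.map Y (Ioi x) :=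
      (Measure.map_apply_of_aemeasurable hY.aemeasurable measurableSet_Ioi).symm
    rw [h1, hY.map_eq, Measure.map_apply hY.measurable_mul measurableSet_Ioi,
      ← expMeasure_one_Ioi hx]
    calc baseMeasure ((fun p : ℝ × ℝ => p.1 * exp (h p.2)) ⁻¹' Ioi x)
        ≤ baseMeasure (Ioi x ×ˢ univ) := by
          refine measure_mono_ae ?_
          filter_upwards [ae_baseMeasure] with p hp hpx
          refine ⟨lt_of_lt_of_le (b := p.1 * exp (h p.2)) hpx ?_, trivial⟩
          exact mul_le_of_le_one_right hp.1.le (exp_le_one_iff.2 (hh _ hp.2))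
      _ = expMeasure 1 (Ioi x) := by
          rw [baseMeasure, Measure.prod_prod, measure_univ, mul_one]
  have hlow : ∀ x : ℝ, 0 ≤ x → ENNReal.ofReal (exp (-(exp (-d) * x))) * angleMeasure (Ioo 0 δ) ≤
      P {ω | x < exp (d + d) * X ω} := fun x hx => by
    have h1 : P {ω | x < exp (d + d) * X ω} = P.map (fun ω => exp (d + d) * X ω) (Ioi x) :=
      (Measure.map_apply_of_aemeasurable hcX.aemeasurable measurableSet_Ioi).symm
    rw [h1, hcX.map_eq, Measure.map_apply hcX.measurable_mul measurableSet_Ioi,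
      ← expMeasure_one_Ioi (by positivity), ← Measure.prod_prod, ← baseMeasure]
    refine measure_mono fun p hp => ?_
    have hp1 : exp (-d) * x < p.1 := hp.1
    have hp2 := hδ _ hp.2
    have hd1 : exp d ≤ exp (d + d + g p.2) := exp_le_exp.2 (by linarith [hg _ hp2.1])
    have hx' : 0 ≤ exp (-d) * x := by positivity
    calc x = exp (-d) * x * exp d := by rw [mul_right_comm, ← exp_add]; simp
      _ < p.1 * exp d := mul_lt_mul_of_pos_right hp1 (exp_pos _)
      _ ≤ p.1 * exp (d + d + g p.2) := mul_le_mul_of_nonneg_left hd1 (hx'.trans hp1.le)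
  have hr : 0 < 1 - exp (-d) := by
    have : exp (-d) < 1 := exp_lt_one_iff.2 (by linarith)
    linarith
  -- The tail of `c * X` is at least a constant times `exp (-(exp (-d) * x))`, that of `Y` at most
  -- `exp (-x)`; comparing them as `x → ∞` forces the constant to vanish.
  have hm : ∀ x : ℝ, 0 ≤ x →
      angleMeasure.real (Ioo 0 δ) ≤ exp (-((1 - exp (-d)) * x)) := fun x hx => by
    have h1 := (hlow x hx).trans ((htail x).trans (hup x hx))
    have h2 := ENNReal.toReal_mono ENNReal.ofReal_ne_top h1
    rw [ENNReal.toReal_mul, ENNReal.toReal_ofReal (exp_pos _).le,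
      ENNReal.toReal_ofReal (exp_pos _).le] at h2
    have h3 : exp (-x) = exp (-(exp (-d) * x)) * exp (-((1 - exp (-d)) * x)) := by
      rw [← exp_add]; ring_nf
    rw [h3] at h2
    exact le_of_mul_le_mul_left h2 (exp_pos _)
  have hlim : Tendsto (fun x : ℝ => exp (-((1 - exp (-d)) * x))) atTop (𝓝 0) :=
    tendsto_exp_neg_atTop_nhds_zero.comp (tendsto_id.const_mul_atTop hr)
  have hzero : angleMeasure.real (Ioo 0 δ) ≤ 0 :=
    ge_of_tendsto hlim ((eventually_ge_atTop 0).mono hm)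
  exact absurd hzero (not_le.2 (ENNReal.toReal_pos (angleMeasure_Ioo_pos hδ0).ne'
    (measure_ne_top _ _)))

end Stochastic

end

noncomputable section

variable {Ω Ω' : Type*} [MeasurableSpace Ω] [MeasurableSpace Ω'] {P : Measure Ω} {Q : Measure Ω'}
  {X : Ω → ℝ} {Y : Ω' → ℝ} {g h : ℝ → ℝ}

/-! ### Convex order by the cut criterion. -/

section Convex

/-- With `m` the right derivative at `c`, chords to the right of `c` have slope at least `m` and
chords to the left at most `m`; so moving away from `c` gains at least the linear amount. -/
lemma exists_slope_of_convexOn {φ : ℝ → ℝ} (hφ : ConvexOn ℝ univ φ) (c : ℝ) :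
    ∃ m : ℝ, ∀ x y, (c ≤ y ∧ y ≤ x) ∨ (x ≤ y ∧ y ≤ c) → m * (x - y) ≤ φ x - φ y := by
  have hint : ∀ x : ℝ, x ∈ interior (univ : Set ℝ) := fun x => by simp
  refine ⟨derivWithin φ (Ioi c) c, fun x y hxy => ?_⟩
  have hmono := hφ.monotoneOn_rightDeriv
  rcases hxy with ⟨h1, h2⟩ | ⟨h1, h2⟩
  · rcases h2.eq_or_lt with rfl | h2
    · simp
    have h3 := hφ.rightDeriv_le_slope_of_mem_interior (hint y) (mem_univ x) h2
    have h4 := (hmono (hint c) (hint y) h1).trans h3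
    rwa [slope_def_field, le_div_iff₀ (by linarith)] at h4
  · rcases h1.eq_or_lt with rfl | h1
    · simp
    have h3 := hφ.slope_le_leftDeriv_of_mem_interior (mem_univ x) (hint y) h1
    have h4 := (h3.trans (hφ.leftDeriv_le_rightDeriv_of_mem_interior (hint y))).trans
      (hmono (hint y) (hint c) h2)
    rw [slope_def_field, div_le_iff₀ (by linarith)] at h4
    linarith

lemma extExpectation_eq_integral {f : Ω → ℝ} (hf : Integrable f P) :
    extExpectation P f = ((∫ ω, f ω ∂P : ℝ) : EReal) := by
  have hfin : ∀ {f : Ω → ℝ}, Integrable f P → ∫⁻ ω, ENNReal.ofReal (f ω) ∂P ≠ ∞ :=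
    fun hf => hf.lintegral_lt_top.ne
  have hfin' := hfin hf.neg
  rw [extExpectation, integral_eq_lintegral_pos_part_sub_lintegral_neg_part hf, EReal.coe_sub,
    EReal.coe_ennreal_toReal (hfin hf)]
  congr 1
  exact (EReal.coe_ennreal_toReal hfin').symm

/-- To compare expectations of a convex function it is enough to compare those of nonnegative
convex functions, when the variables have the same mean. -/
lemma extExpectation_le_of_nonneg_convex [IsProbabilityMeasure P] [IsProbabilityMeasure Q]
    (hX : Integrable X P) (hY : Integrable Y Q) (hmean : ∫ ω, X ω ∂P = ∫ ω, Y ω ∂Q)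
    (hle : ∀ ψ : ℝ → ℝ, ConvexOn ℝ univ ψ → (∀ x, 0 ≤ ψ x) →
      ∫⁻ ω, ENNReal.ofReal (ψ (X ω)) ∂P ≤ ∫⁻ ω, ENNReal.ofReal (ψ (Y ω)) ∂Q)
    {φ : ℝ → ℝ} (hφ : ConvexOn ℝ univ φ) :
    extExpectation P (fun ω => φ (X ω)) ≤ extExpectation Q (fun ω => φ (Y ω)) := by
  have hcont : Continuous φ := by
    rw [← continuousOn_univ]; exact hφ.continuousOn isOpen_univ
  obtain ⟨m, hm⟩ := exists_slope_of_convexOn hφ 0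
  have hmin : ∀ x, φ 0 + m * x ≤ φ x := fun x => by
    have := hm x 0 (by rcases le_total 0 x with h | h <;> simp [h])
    linarith
  have hAX : Integrable (fun ω => φ 0 + m * X ω) P := (integrable_const _).add (hX.const_mul m)
  have hAY : Integrable (fun ω => φ 0 + m * Y ω) Q := (integrable_const _).add (hY.const_mul m)
  have hnegfin : ∫⁻ ω, ENNReal.ofReal (-φ (Y ω)) ∂Q ≠ ∞ := by
    refine ((lintegral_mono fun ω => ENNReal.ofReal_le_ofReal ?_).trans_lt
      hAY.neg.lintegral_lt_top).ne
    exact neg_le_neg (hmin _)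
  have hφY : AEMeasurable (fun ω => φ (Y ω)) Q :=
    hcont.measurable.comp_aemeasurable hY.aemeasurable
  have hφX : AEMeasurable (fun ω => φ (X ω)) P :=
    hcont.measurable.comp_aemeasurable hX.aemeasurable
  by_cases hpos : ∫⁻ ω, ENNReal.ofReal (φ (Y ω)) ∂Q = ∞
  · have htop : extExpectation Q (fun ω => φ (Y ω)) = ⊤ := by
      rw [extExpectation, hpos, EReal.coe_ennreal_top, ← EReal.coe_ennreal_toReal hnegfin]
      exact EReal.top_sub_coe _
    rw [htop]
    exact le_top
  · have hiY : Integrable (fun ω => φ (Y ω)) Q := by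
      refine ⟨hφY.aestronglyMeasurable, ?_⟩
      rw [hasFiniteIntegral_iff_norm]
      refine lt_of_le_of_lt (b := ∫⁻ ω, (ENNReal.ofReal (φ (Y ω)) + ENNReal.ofReal (-φ (Y ω))) ∂Q)
        (lintegral_mono fun ω => ?_) ?_
      · rw [norm_eq_abs]
        rcases le_total 0 (φ (Y ω)) with h | h
        · rw [abs_of_nonneg h]; exact le_self_add
        · rw [abs_of_nonpos h]; exact le_add_self
      · rw [lintegral_add_left' hφY.ennreal_ofReal]
        exact ENNReal.add_lt_top.2 ⟨lt_top_iff_ne_top.2 hpos, lt_top_iff_ne_top.2 hnegfin⟩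
    -- Subtracting the supporting line at `0` makes the function nonnegative, and equal means make
    -- the line contribute equally to both sides.
    set ψ : ℝ → ℝ := fun x => φ x - (φ 0 + m * x) with hψ
    have hψc : ConvexOn ℝ univ ψ := by
      have hlin : ConcaveOn ℝ univ fun x : ℝ => φ 0 + m * x := by
        refine ⟨convex_univ, fun x _ y _ a b _ _ hab => le_of_eq ?_⟩
        simp only [smul_eq_mul]
        linear_combination (φ 0) * hab
      exact hφ.sub hlin
    have hψ0 : ∀ x, 0 ≤ ψ x := fun x => sub_nonneg.2 (hmin x)
    have hψY : Integrable (fun ω => ψ (Y ω)) Q := hiY.sub hAY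
    have hψm : AEStronglyMeasurable (fun ω => ψ (X ω)) P :=
      hφX.aestronglyMeasurable.sub hAX.aestronglyMeasurable
    have hcomp := hle ψ hψc hψ0
    have hψX : Integrable (fun ω => ψ (X ω)) P := by
      refine ⟨hψm, ?_⟩
      rw [hasFiniteIntegral_iff_ofReal (ae_of_all _ fun ω => hψ0 _)]
      exact hcomp.trans_lt hψY.lintegral_lt_top
    have hiX : Integrable (fun ω => φ (X ω)) P :=
      (hψX.add hAX).congr (ae_of_all _ fun ω => by simp [hψ])
    rw [extExpectation_eq_integral hiX, extExpectation_eq_integral hiY, EReal.coe_le_coe_iff]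
    have hψle : ∫ ω, ψ (X ω) ∂P ≤ ∫ ω, ψ (Y ω) ∂Q := by
      rw [integral_eq_lintegral_of_nonneg_ae (ae_of_all _ fun ω => hψ0 _) hψm,
        integral_eq_lintegral_of_nonneg_ae (ae_of_all _ fun ω => hψ0 _) hψY.aestronglyMeasurable]
      exact ENNReal.toReal_mono hψY.lintegral_lt_top.ne hcomp
    have hA : ∫ ω, (φ 0 + m * X ω) ∂P = ∫ ω, (φ 0 + m * Y ω) ∂Q := by
      rw [integral_add (integrable_const _) (hX.const_mul m),
        integral_add (integrable_const _) (hY.const_mul m), integral_const_mul,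
        integral_const_mul, hmean]
      simp
    rw [integral_sub hiX hAX, integral_sub hiY hAY, hA] at hψle
    linarith

/-- If `g` and `h - g` are nonincreasing, then `exp ∘ h` crosses `exp ∘ g` at most once, from
above. -/
lemma exists_crossing {B : ℝ} (hg : AntitoneOn g (Ioo 0 π))
    (hgh : AntitoneOn (fun u => h u - g u) (Ioo 0 π)) (hB : ∀ u ∈ Ioo 0 π, g u ≤ B) :
    ∃ c, ∀ u ∈ Ioo 0 π, (c ≤ exp (g u) ∧ exp (g u) ≤ exp (h u)) ∨
      (exp (h u) ≤ exp (g u) ∧ exp (g u) ≤ c) := by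
  by_cases h1 : ∀ u ∈ Ioo 0 π, h u ≤ g u
  · exact ⟨exp B, fun u hu => Or.inr ⟨exp_le_exp.2 (h1 u hu), exp_le_exp.2 (hB u hu)⟩⟩
  by_cases h2 : ∀ u ∈ Ioo 0 π, g u ≤ h u
  · exact ⟨0, fun u hu => Or.inl ⟨(exp_pos _).le, exp_le_exp.2 (h2 u hu)⟩⟩
  push Not at h1 h2
  obtain ⟨a, ha, hga⟩ := h1
  obtain ⟨b, hb, hgb⟩ := h2
  set D := {u | u ∈ Ioo 0 π ∧ g u ≤ h u} with hD
  have hdown : ∀ u ∈ Ioo 0 π, ∀ v ∈ D, u ≤ v → u ∈ D := fun u hu v hv huv => by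
    have h3 := hgh hu hv.1 huv
    have h4 := hv.2
    simp only at h3
    exact ⟨hu, by linarith⟩
  have hbD : b ∈ upperBounds D := fun v hv => by
    by_contra hlt
    exact absurd (hdown b hb v hv (not_le.1 hlt).le).2 (not_le.2 hgb)
  have haD : a ∈ D := ⟨ha, hga.le⟩
  have hu0 : sSup D ∈ Ioo 0 π :=
    ⟨ha.1.trans_le (le_csSup ⟨b, hbD⟩ haD), (csSup_le ⟨a, haD⟩ hbD).trans_lt hb.2⟩
  -- The crossing level is the value of `exp ∘ g` at the crossing angle, the end of the initial
  -- interval where `g ≤ h`.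
  refine ⟨exp (g (sSup D)), fun u hu => ?_⟩
  simp only [exp_le_exp]
  by_cases huD : u ∈ D
  · exact Or.inl ⟨hg hu hu0 (le_csSup ⟨b, hbD⟩ huD), huD.2⟩
  · have h5 : sSup D ≤ u := csSup_le ⟨a, haD⟩ fun v hv => by
      by_contra hlt
      exact huD (hdown u hu v hv (not_le.1 hlt).le)
    refine Or.inr ⟨?_, hg hu0 hu h5⟩
    by_contra hlt
    exact huD ⟨hu, (not_le.1 hlt).le⟩

lemma integrable_comp_mul_exp {ψ : ℝ → ℝ} (hψ : Continuous ψ) (hg : Measurable g) {B : ℝ}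
    (hB : ∀ u ∈ Ioo 0 π, g u ≤ B) {l : ℝ} (hl : 0 < l) :
    Integrable (fun u => ψ (l * exp (g u))) angleMeasure := by
  obtain ⟨C, hC⟩ := (isCompact_Icc (a := (0 : ℝ)) (b := l * exp B)).exists_bound_of_continuousOn
    hψ.continuousOn
  have hm := hψ.measurable
  refine Integrable.of_bound (Measurable.aestronglyMeasurable (by fun_prop)) C ?_
  filter_upwards [ae_angleMeasure] with u hu
  exact hC _ ⟨by positivity, mul_le_mul_of_nonneg_left (exp_le_exp.2 (hB u hu)) hl.le⟩

/-- Cut criterion for fixed `l`: `l * exp (h u)` is always farther than `l * exp (g u)` from the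
level `l * c`, on the same side. The increment of `ψ` therefore dominates a linear one, whose
integral vanishes by equality of means. -/
lemma lintegral_convex_le {B : ℝ} (hgm : Measurable g) (hhm : Measurable h)
    (hg : AntitoneOn g (Ioo 0 π)) (hgh : AntitoneOn (fun u => h u - g u) (Ioo 0 π))
    (hgB : ∀ u ∈ Ioo 0 π, g u ≤ B) (hhB : ∀ u ∈ Ioo 0 π, h u ≤ B)
    (hmean : ∫ u, exp (g u) ∂angleMeasure = ∫ u, exp (h u) ∂angleMeasure)
    {ψ : ℝ → ℝ} (hψ : ConvexOn ℝ univ ψ) (hψ0 : ∀ x, 0 ≤ ψ x) :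
    ∫⁻ p, ENNReal.ofReal (ψ (p.1 * exp (g p.2))) ∂baseMeasure ≤
      ∫⁻ p, ENNReal.ofReal (ψ (p.1 * exp (h p.2))) ∂baseMeasure := by
  have hcont : Continuous ψ := by
    rw [← continuousOn_univ]; exact hψ.continuousOn isOpen_univ
  have hm := hcont.measurable
  obtain ⟨c, hc⟩ := exists_crossing hg hgh hgB
  rw [baseMeasure, lintegral_prod _ (Measurable.aemeasurable (by fun_prop)),
    lintegral_prod _ (Measurable.aemeasurable (by fun_prop))]
  refine lintegral_mono_ae ?_
  filter_upwards [ae_expMeasure_one] with l hl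
  have hIg := integrable_comp_mul_exp hcont hgm hgB hl
  have hIh := integrable_comp_mul_exp hcont hhm hhB hl
  rw [← ofReal_integral_eq_lintegral_ofReal hIg (ae_of_all _ fun u => hψ0 _),
    ← ofReal_integral_eq_lintegral_ofReal hIh (ae_of_all _ fun u => hψ0 _)]
  refine ENNReal.ofReal_le_ofReal ?_
  obtain ⟨m, hslope⟩ := exists_slope_of_convexOn hψ (l * c)
  have hEg : Integrable (fun u => l * exp (g u)) angleMeasure :=
    integrable_comp_mul_exp continuous_id hgm hgB hl
  have hEh : Integrable (fun u => l * exp (h u)) angleMeasure :=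
    integrable_comp_mul_exp continuous_id hhm hhB hl
  have hle : ∫ u, m * (l * exp (h u) - l * exp (g u)) ∂angleMeasure ≤
      ∫ u, (ψ (l * exp (h u)) - ψ (l * exp (g u))) ∂angleMeasure := by
    refine integral_mono_ae ((hEh.sub hEg).const_mul m) (hIh.sub hIg) ?_
    filter_upwards [ae_angleMeasure] with u hu
    refine hslope _ _ ?_
    rcases hc u hu with ⟨h1, h2⟩ | ⟨h1, h2⟩
    · exact Or.inl ⟨mul_le_mul_of_nonneg_left h1 hl.le, mul_le_mul_of_nonneg_left h2 hl.le⟩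
    · exact Or.inr ⟨mul_le_mul_of_nonneg_left h1 hl.le, mul_le_mul_of_nonneg_left h2 hl.le⟩
  have hzero : ∫ u, m * (l * exp (h u) - l * exp (g u)) ∂angleMeasure = 0 := by
    rw [integral_const_mul, integral_sub hEh hEg, integral_const_mul, integral_const_mul, hmean,
      sub_self, mul_zero]
  rw [hzero, integral_sub hIh hIg] at hle
  linarith

lemma integrable_mul_exp {B : ℝ} (hg : Measurable g) (hB : ∀ u ∈ Ioo 0 π, g u ≤ B) :
    Integrable (fun p : ℝ × ℝ => p.1 * exp (g p.2)) baseMeasure := by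
  have h1 : Integrable (fun x : ℝ => x) (expMeasure 1) := by
    refine ⟨by fun_prop, ?_⟩
    rw [hasFiniteIntegral_iff_ofReal (ae_expMeasure_one.mono fun x hx => le_of_lt hx)]
    have := lintegral_rpow_expMeasure_one zero_le_one
    simp only [rpow_one] at this
    rw [this]
    exact ENNReal.ofReal_lt_top
  have h2 : Integrable (fun u => exp (g u)) angleMeasure := by
    simpa using integrable_comp_mul_exp continuous_id hg hB one_pos
  exact h1.mul_prod h2

lemma convexLE_of_antitone {B : ℝ} (hX : IsExpMixture P X g) (hY : IsExpMixture Q Y h)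
    (hg : AntitoneOn g (Ioo 0 π)) (hgh : AntitoneOn (fun u => h u - g u) (Ioo 0 π))
    (hgB : ∀ u ∈ Ioo 0 π, g u ≤ B) (hhB : ∀ u ∈ Ioo 0 π, h u ≤ B)
    (hmean : ∫ u, exp (g u) ∂angleMeasure = ∫ u, exp (h u) ∂angleMeasure) :
    ConvexLE P Q X Y := by
  intro φ hφ _ _
  have hcont : Continuous φ := by
    rw [← continuousOn_univ]; exact hφ.continuousOn isOpen_univ
  rw [hX.extExpectation_comp hcont.measurable, hY.extExpectation_comp hcont.measurable]
  refine extExpectation_le_of_nonneg_convex (integrable_mul_exp hX.measurable hgB)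
    (integrable_mul_exp hY.measurable hhB) ?_ (fun ψ hψ hψ0 => lintegral_convex_le hX.measurable
      hY.measurable hg hgh hgB hhB hmean hψ hψ0) hφ
  rw [baseMeasure, integral_prod_mul (fun x : ℝ => x) fun u => exp (g u),
    integral_prod_mul (fun x : ℝ => x) fun u => exp (h u), hmean]

end Convex

/-! ### Means and normalizing constants. -/

section Means

/-- Read off from the first moment: the negative moment formula at `s = α / (1 - α)` is a quotient
of consecutive Gamma values, equal to `1 / (1 - α)`, and the exponential factor has mean 1. -/
lemma integral_exp_logKanter_eq [IsProbabilityMeasure P] {α : ℝ} (h0 : 0 < α) (h1 : α < 1)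
    (hX : IsPositiveStable P α X) :
    ∫ u, exp (logKanter α u) ∂angleMeasure = α ^ (α / (1 - α)) := by
  have h1a : 0 < 1 - α := by linarith
  have hlaw := isExpMixture_stable h0 h1 hX
  have e1 := hlaw.lintegral_comp (f := fun x => ENNReal.ofReal (x ^ (1 : ℝ))) (by fun_prop)
  rw [lintegral_rpow_base (measurable_logKanter α) (fun u hu => logKanter_nonpos h0.le h1 hu)
    zero_le_one] at e1
  have hγ : 0 < α / (1 - α) := div_pos h0 h1a
  have hc : 0 ≤ (1 - α) * α ^ (α / (1 - α)) := by positivity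
  have e2 := lintegral_rpow_neg_of_isPositiveStable h0 hX hγ
  simp only [rpow_one, one_mul, ENNReal.ofReal_mul hc, ← neg_div] at e1 e2
  rw [lintegral_const_mul' _ _ ENNReal.ofReal_ne_top, e2, ← ENNReal.ofReal_mul hc] at e1
  have hI : 0 ≤ ∫ u, exp (logKanter α u) ∂angleMeasure :=
    integral_nonneg fun u => (exp_pos _).le
  have hq : 0 < 1 / (1 - α) := by positivity
  have g1 : 1 + α / (1 - α) / α = 1 / (1 - α) + 1 := by field_simp; ring
  have g2 : 1 + α / (1 - α) = 1 / (1 - α) := by field_simp; ring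
  have hΓ := Gamma_pos_of_pos hq
  rw [g1, g2, Gamma_add_one hq.ne', one_add_one_eq_two, Gamma_two, one_mul,
    ENNReal.ofReal_eq_ofReal_iff (by positivity) hI] at e1
  rw [← e1]
  field_simp

/-- The exponent `1` lies outside the range of `integral_exp_mul_logKanterOne`, so the analytically
continued transform is evaluated at `z = 1`. -/
lemma integral_exp_logKanterOne_eq :
    ∫ u, exp (logKanterOne u) ∂angleMeasure = exp (-1) := by
  have e1 : complexMGF logLimit baseMeasure ((1 : ℝ) : ℂ) = ((exp (-1) : ℝ) : ℂ) := by
    rw [complexMGF_logLimit (by simp)]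
    simp
  rw [complexMGF_ofReal, Complex.ofReal_inj, mgf, integral_eq_lintegral_of_nonneg_ae
    (ae_of_all _ fun x => (exp_pos _).le)
    (integrable_exp_mul_logLimit zero_le_one).aestronglyMeasurable,
    lintegral_congr_ae ((exp_mul_logLimit 1).mono fun p hp => by rw [hp]),
    lintegral_rpow_base measurable_logKanterOne (fun u hu => logKanterOne_nonpos hu) zero_le_one,
    one_add_one_eq_two, Gamma_two, one_mul, ENNReal.toReal_ofReal] at e1
  · simpa using e1
  · exact integral_nonneg fun u => (exp_pos _).le

lemma isExpMixture_stable_normalized [IsProbabilityMeasure P] {α : ℝ} (h0 : 0 < α) (h1 : α < 1)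
    (hX : IsPositiveStable P α X) :
    IsExpMixture P (fun ω => (1 - α) * X ω ^ (-α / (1 - α)))
      (fun u => -(log α * (α / (1 - α))) + logKanter α u) := by
  have h := (isExpMixture_stable h0 h1 hX).const_mul (-(log α * (α / (1 - α))))
  have e : ∀ ω, exp (-(log α * (α / (1 - α)))) *
      ((1 - α) * α ^ (α / (1 - α)) * X ω ^ (-α / (1 - α))) =
      (1 - α) * X ω ^ (-α / (1 - α)) := fun ω => by
    rw [rpow_def_of_pos h0, exp_neg]
    field_simp
  simpa only [e] using h

lemma integral_exp_normalized [IsProbabilityMeasure P] {α : ℝ} (h0 : 0 < α) (h1 : α < 1)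
    (hX : IsPositiveStable P α X) :
    ∫ u, exp (-(log α * (α / (1 - α))) + logKanter α u) ∂angleMeasure = 1 := by
  simp_rw [exp_add]
  rw [integral_const_mul, integral_exp_logKanter_eq h0 h1 hX, rpow_def_of_pos h0, ← exp_add,
    neg_add_cancel, exp_zero]

lemma integral_exp_one_add_logKanterOne :
    ∫ u, exp (1 + logKanterOne u) ∂angleMeasure = 1 := by
  simp_rw [exp_add]
  rw [integral_const_mul, integral_exp_logKanterOne_eq, ← exp_add, add_neg_cancel, exp_zero]

end Means

lemma antitoneOn_add_sub_add {c d : ℝ} (hgh : AntitoneOn (fun u => h u - g u) (Ioo 0 π)) :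
    AntitoneOn (fun u => (c + h u) - (d + g u)) (Ioo 0 π) := fun u hu v hv huv => by
  have := hgh hu hv huv
  simp only at this ⊢
  linarith

end

end KanterOrder

/-! ### Assembly of the two chains. -/

open KanterOrder in
theorem theoremA {α β : ℝ} (hβ : 0 < β) (hβα : β < α) (hα : α < 1)
    {Ω₁ Ω₂ Ω₃ Ω₄ : Type*} [MeasurableSpace Ω₁] [MeasurableSpace Ω₂]
    [MeasurableSpace Ω₃] [MeasurableSpace Ω₄]
    (P₁ : Measure Ω₁) [IsProbabilityMeasure P₁] (P₂ : Measure Ω₂) [IsProbabilityMeasure P₂]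
    (P₃ : Measure Ω₃) [IsProbabilityMeasure P₃] (P₄ : Measure Ω₄) [IsProbabilityMeasure P₄]
    (S : Ω₁ → ℝ) (hS : IsLogStable P₁ S)
    (Zα : Ω₂ → ℝ) (hZα : IsPositiveStable P₂ α Zα)
    (Zβ : Ω₃ → ℝ) (hZβ : IsPositiveStable P₃ β Zβ)
    (L : Ω₄ → ℝ) (hL : HasLaw L (expMeasure 1) P₄) :
    (OptimalStochasticLE P₁ P₂ S
        (fun ω => (1 - α) * α ^ (α / (1 - α)) * Zα ω ^ (-α / (1 - α))) ∧
      OptimalStochasticLE P₂ P₃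
        (fun ω => (1 - α) * α ^ (α / (1 - α)) * Zα ω ^ (-α / (1 - α)))
        (fun ω => (1 - β) * β ^ (β / (1 - β)) * Zβ ω ^ (-β / (1 - β))) ∧
      OptimalStochasticLE P₃ P₄
        (fun ω => (1 - β) * β ^ (β / (1 - β)) * Zβ ω ^ (-β / (1 - β))) L) ∧
    (ConvexLE P₄ P₃ L (fun ω => (1 - β) * Zβ ω ^ (-β / (1 - β))) ∧
      ConvexLE P₃ P₂ (fun ω => (1 - β) * Zβ ω ^ (-β / (1 - β)))
        (fun ω => (1 - α) * Zα ω ^ (-α / (1 - α))) ∧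
      ConvexLE P₂ P₁ (fun ω => (1 - α) * Zα ω ^ (-α / (1 - α)))
        (fun ω => Real.exp 1 * S ω)) := by
  have hα0 : 0 < α := hβ.trans hβα
  have hβ1 : β < 1 := hβα.trans hα
  have hβn := fun u hu => logKanter_nonpos (u := u) hβ.le hβ1 hu
  have hαn := fun u hu => logKanter_nonpos (u := u) hα0.le hα hu
  have hS' := isExpMixture_logStable hS
  have hα' := isExpMixture_stable hα0 hα hZα
  have hβ' := isExpMixture_stable hβ hβ1 hZβ
  have hL' := isExpMixture_exp hL
  have hα'' := isExpMixture_stable_normalized hα0 hα hZα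
  have hβ'' := isExpMixture_stable_normalized hβ hβ1 hZβ
  have hαm := integral_exp_normalized hα0 hα hZα
  have hβm := integral_exp_normalized hβ hβ1 hZβ
  set cα := -(Real.log α * (α / (1 - α)))
  set cβ := -(Real.log β * (β / (1 - β)))
  refine ⟨⟨?_, ?_, ?_⟩, ?_, ?_, ?_⟩
  · exact optimalStochasticLE_of_le hS' hα' (fun u hu => logKanterOne_le hα0.le hα hu)
      (fun u _ => le_rfl) hαn
  · exact optimalStochasticLE_of_le hα' hβ' (fun u hu => logKanter_anti hβ.le hβα.le hα hu)
      (fun u hu => logKanterOne_le hα0.le hα hu) hβn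
  · exact optimalStochasticLE_of_le hβ' hL' hβn
      (fun u hu => logKanterOne_le hβ.le hβ1 hu) (fun u _ => le_rfl)
  -- Here and below `B` is just a common upper bound of the two mixing functions, each of which is a
  -- constant plus a nonpositive function.
  · refine convexLE_of_antitone (B := max 0 cβ) hL' hβ'' antitoneOn_const ?_
      (fun u _ => le_max_left _ _) (fun u hu => le_max_of_le_right (by linarith [hβn u hu])) ?_
    · simpa using! (antitoneOn_logKanter hβ.le hβ1).const_add cβ
    · rw [hβm]; simp
  · refine convexLE_of_antitone (B := max cβ cα) hβ'' hα''
      ((antitoneOn_logKanter hβ.le hβ1).const_add cβ)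
      (antitoneOn_add_sub_add (antitoneOn_logKanter_sub hβ.le hβα.le hα))
      (fun u hu => le_max_of_le_left (by linarith [hβn u hu]))
      (fun u hu => le_max_of_le_right (by linarith [hαn u hu])) (hβm.trans hαm.symm)
  · refine convexLE_of_antitone (B := max cα 1) hα'' (hS'.const_mul 1)
      ((antitoneOn_logKanter hα0.le hα).const_add cα)
      (antitoneOn_add_sub_add (antitoneOn_logKanterOne_sub hα0.le hα))
      (fun u hu => le_max_of_le_left (by linarith [hαn u hu]))
      (fun u hu => le_max_of_le_right (by linarith [logKanterOne_nonpos hu]))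
      (hαm.trans integral_exp_one_add_logKanterOne.symm)
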